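/- **Conventions.** $\Sigma=\{\Sigma_n\}$ is the operad of symmetric groups, with $\mu(\sigma;\tau_1,\dots,\tau_n)$ the permutation sending the element $a$ of the $i$-th block to the element $\tau_i(a)$ of the $\sigma(i)$-th block. An *action operad* $\Lambda$ consists of groups $\Lambda(n)$, $n\ge 0$, an operad structure (unit in $\Lambda(1)$, multiplications $\mu:\Lambda(n)\times\Lambda(k_1)\times\cdots\times\Lambda(k_n)\to\Lambda(k_1+\cdots+k_n)$, associative and unital) on the underlying sets, and group homomorphisms $\pi_n:\Lambda(n)\to\Sigma_n$ which form a map of operads, such that $$\mu(g;f_1,\dots,f_n)\,\mu(g';f_1',\dots,f_n')=\mu\bigl(gg';f_{\pi(g')(1)}f_1',\dots,f_{\pi(g')(n)}f_n'\bigr)$$ whenever $f_i'\in\Lambda(k_i)$ and $f_j\in\Lambda(k_{\pi(g')^{-1}(j)})$. For a set $S$ let $ES$ be the category with object set $S$ and exactly one morphism between any two objects. Let $B\Lambda=\coprod_n B\Lambda(n)$ be the category with objects the natural numbers, $B\Lambda(n,n)=\Lambda(n)$ and no morphisms $m\to n$ for $m\neq n$; $B\pi:B\Lambda\to B\Sigma$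 is the identity on objects and $\pi$ on morphisms. The *Borel construction* is the monad $E\Lambda$ on the category $\mathbf{Cat}$ of small categories, $$E\Lambda(X)=\coprod_{n\ge0}E\Lambda(n)\times_{\Lambda(n)}X^n,$$ where $E\Lambda(n)\times_{\Lambda(n)}X^n$ is the coequalizer, over all $h\in\Lambda(n)$, of the two actions $(g;x_1,\dots,x_n)\mapsto(gh;x_1,\dots,x_n)$ and $(g;x_1,\dots,x_n)\mapsto(g;x_{\pi(h)^{-1}(1)},\dots,x_{\pi(h)^{-1}(n)})$ on $E\Lambda(n)\times X^n$, and whose unit and multiplication are induced by the operad structure of $\Lambda$ and concatenation of tuples. In particular there are the monad $E\Sigma$, the transformation $\tilde\pi:E\Lambda\Rightarrow E\Sigma$ induced by $[g;x_1,\dots,x_n]\mapsto[\pi(g);x_1,\dots,x_n]$, and canonical isomorphisms $B\Lambda\cong E\Lambda(1)$, $B\Sigma\cong E\Sigma(1)$, where $1$ is the terminal category. A monad $(T,\eta,\mu)$ on a category $C$ with finite limits is *cartesian* if $T$ preserves pullbacks and all naturality squares of $\eta$ and of $\mu$ are pullbacks; a natural transformation is cartesian if all its naturality squares are pullbacks.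 For $x:X\to T1$ and $y:Y\to T1$ the composition product $X\circ Y$ is the pullback $X\times_{T1}TY$ of $x$ along $T!:TY\to T1$, with the map $X\circ Y\to TY\xrightarrow{Ty}T^21\xrightarrow{\mu}T1$ to $T1$. For cartesian $T$ this gives $C/T1$ a monoidal structure with unit $\eta:1\to T1$, and a *$T$-operad* is a monoid in it. A $T$-operad $k:K\to T1$ induces a monad $X\mapsto K\times_{T1}TX$ on $C$, with a projection to $T$. A *club* is a $T$-operad in $\mathbf{Cat}$ for $T=E\Sigma$. **Theorem.** Let $\Lambda$ be an action operad. Then: 1. $E\Lambda$ and $E\Sigma$ are cartesian monads. 2. $\tilde\pi:E\Lambda\Rightarrow E\Sigma$ is cartesian and commutes with the units and the multiplications of the two monads. 3. The functor $B\pi:B\Lambda\to B\Sigma\cong E\Sigma(1)$ carries the structure of a club whose induced monad $X\mapsto B\Lambda\times_{E\Sigma(1)}E\Sigma(X)$ is isomorphic, as a monad, to $E\Lambda$. Under this isomorphism, for every $X$, the projection to $E\Sigma(X)$ corresponds to $\tilde\pi_X$, and the projection to $B\Lambda$ corresponds to $E\Lambda(!):E\Lambda(X)\to E\Lambda(1)\cong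 B\Lambda$. -/

import Mathlib

open CategoryTheory CategoryTheory.Limits

universe w v u v' u'

set_option linter.unusedSimpArgs false
set_option linter.unusedSectionVars false

/-! ### Blocks -/

theorem sum_reindex {n : ℕ} (σ : Equiv.Perm (Fin n)) {k k' : Fin n → ℕ}
    (hk : ∀ i, k' (σ i) = k i) : ∑ j, k' j = ∑ i, k i := by
  rw [← Equiv.sum_comp σ k']
  exact Finset.sum_congr rfl fun i _ => hk i

/-- The operadic composite `μ(σ; τ₁, …, τₙ)` of permutations. Identify `Fin (k₁ + ⋯ + kₙ)` with the
pairs `(i, a)`, `a < kᵢ`, in lexicographic order; then `(i, a)` is sent to `(σ i, τᵢ a)`, where the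
`j`-th block of the target has length `k (σ⁻¹ j)`. -/
def blockPerm {n : ℕ} {k : Fin n → ℕ} (σ : Equiv.Perm (Fin n))
    (τ : ∀ i, Equiv.Perm (Fin (k i))) : Equiv.Perm (Fin (∑ i, k i)) :=
  finSigmaFinEquiv.symm.trans <|
    (Equiv.sigmaCongr (β₂ := fun j => Fin (k (σ.symm j))) σ
      fun i => (τ i).trans (finCongr (by simp))).trans <|
    finSigmaFinEquiv.trans (finCongr (sum_reindex σ (by simp)))

theorem blockPerm_apply {n : ℕ} {k k' : Fin n → ℕ} (σ : Equiv.Perm (Fin n))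
    (τ : ∀ i, Equiv.Perm (Fin (k i))) (hk : ∀ i, k' (σ i) = k i) (i : Fin n) (a : Fin (k i)) :
    (blockPerm σ τ (finSigmaFinEquiv ⟨i, a⟩)).val =
      (finSigmaFinEquiv (n := k') ⟨σ i, Fin.cast (hk i).symm (τ i a)⟩).val := by
  obtain rfl : k' = fun j => k (σ.symm j) := by
    funext j; simpa using hk (σ.symm j)
  simp [blockPerm, Equiv.sigmaCongr, Equiv.sigmaCongrLeft]

theorem finSigma_val_congr {m n : ℕ} (h : m = n) {k : Fin m → ℕ} {l : Fin n → ℕ}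
    (hkl : ∀ i j, i.val = j.val → k i = l j) {p : Σ i, Fin (k i)} {q : Σ i, Fin (l i)}
    (h1 : p.1.val = q.1.val) (h2 : p.2.val = q.2.val) :
    (finSigmaFinEquiv p).val = (finSigmaFinEquiv q).val := by
  subst h
  obtain rfl : k = l := funext fun i => hkl i i rfl
  obtain ⟨i, a⟩ := p
  obtain ⟨j, b⟩ := q
  obtain rfl : i = j := Fin.ext h1
  obtain rfl : a = b := Fin.ext h2
  rfl

theorem finSigma_val_inj {m n : ℕ} (h : m = n) {k : Fin m → ℕ} {l : Fin n → ℕ}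
    (hkl : ∀ i j, i.val = j.val → k i = l j) {p : Σ i, Fin (k i)} {q : Σ i, Fin (l i)}
    (he : (finSigmaFinEquiv p).val = (finSigmaFinEquiv q).val) :
    p.1.val = q.1.val ∧ p.2.val = q.2.val := by
  subst h
  obtain rfl : k = l := funext fun i => hkl i i rfl
  obtain rfl : p = q := finSigmaFinEquiv.injective (Fin.ext he)
  exact ⟨rfl, rfl⟩

theorem finSigma_lt {m : ℕ} {k : Fin m → ℕ} (p q : Σ i, Fin (k i)) :
    finSigmaFinEquiv p < finSigmaFinEquiv q ↔
      p.1 < q.1 ∨ p.1 = q.1 ∧ p.2.val < q.2.val := by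
  have key : ∀ p q : Σ i, Fin (k i), p.1 < q.1 →
      finSigmaFinEquiv p < finSigmaFinEquiv q := by
    rintro ⟨i, a⟩ ⟨j, b⟩ h
    rw [Fin.lt_def, finSigmaFinEquiv_apply, finSigmaFinEquiv_apply]
    have h' : i.val + 1 ≤ j.val := h
    have e1 : ∑ x : Fin j.val, k (Fin.castLE j.2.le x) =
        ∑ x ∈ Finset.range j.val, if hx : x < m then k ⟨x, hx⟩ else 0 := by
      rw [Finset.sum_range]
      refine Finset.sum_congr rfl fun x _ => ?_
      rw [dif_pos (x.2.trans j.2)]; rfl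
    have e2 : ∑ x : Fin i.val, k (Fin.castLE i.2.le x) =
        ∑ x ∈ Finset.range i.val, if hx : x < m then k ⟨x, hx⟩ else 0 := by
      rw [Finset.sum_range]
      refine Finset.sum_congr rfl fun x _ => ?_
      rw [dif_pos (x.2.trans i.2)]; rfl
    have e3 : ∑ x ∈ Finset.range (i.val + 1), (if hx : x < m then k ⟨x, hx⟩ else 0) ≤
        ∑ x ∈ Finset.range j.val, if hx : x < m then k ⟨x, hx⟩ else 0 :=
      Finset.sum_le_sum_of_subset (by simpa using h')
    rw [Finset.sum_range_succ, dif_pos i.2] at e3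
    have := a.2
    simp only at this ⊢
    rw [e1, e2]
    simp only [Fin.eta] at e3
    omega
  have key2 : ∀ (i : Fin m) (a b : Fin (k i)), a < b →
      finSigmaFinEquiv (n := k) ⟨i, a⟩ < finSigmaFinEquiv (n := k) ⟨i, b⟩ := by
    intro i a b h
    rw [Fin.lt_def, finSigmaFinEquiv_apply, finSigmaFinEquiv_apply]
    simpa using h
  constructor
  · intro h
    rcases lt_trichotomy p.1 q.1 with h1 | h1 | h1
    · exact Or.inl h1
    · refine Or.inr ⟨h1, ?_⟩
      obtain ⟨i, a⟩ := p
      obtain ⟨j, b⟩ := q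
      obtain rfl : i = j := h1
      by_contra hc
      rcases (not_lt.mp hc).lt_or_eq with h2 | h2
      · exact absurd (key2 i b a h2) h.asymm
      · obtain rfl : b = a := Fin.ext h2
        exact lt_irrefl _ h
    · exact absurd (key q p h1) h.asymm
  · rintro (h | ⟨h1, h2⟩)
    · exact key p q h
    · obtain ⟨i, a⟩ := p
      obtain ⟨j, b⟩ := q
      obtain rfl : i = j := h1
      exact key2 i a b h2

theorem sum_blocks {n : ℕ} {k : Fin n → ℕ} (p : ∀ i, Fin (k i) → ℕ) :
    ∑ a, p (finSigmaFinEquiv.symm a).1 (finSigmaFinEquiv.symm a).2 = ∑ i, ∑ j, p i j := by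
  rw [Equiv.sum_comp finSigmaFinEquiv.symm (fun x : Σ i, Fin (k i) => p x.1 x.2),
    Fintype.sum_sigma]

theorem finSigma_val {m : ℕ} {k : Fin m → ℕ} (i : Fin m) (a : Fin (k i)) :
    (finSigmaFinEquiv (n := k) ⟨i, a⟩).val = (∑ x, if x < i then k x else 0) + a.val := by
  rw [finSigmaFinEquiv_apply]
  congr 1
  have e1 : ∑ x : Fin i.val, k (Fin.castLE i.2.le x) =
      ∑ x ∈ Finset.range i.val, if hx : x < m then k ⟨x, hx⟩ else 0 := by
    rw [Finset.sum_range]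
    refine Finset.sum_congr rfl fun x _ => ?_
    rw [dif_pos (x.2.trans i.2)]; rfl
  have e2 : (∑ x : Fin m, if x < i then k x else 0) = ∑ x ∈ Finset.range m,
      if x < i.val then (if hx : x < m then k ⟨x, hx⟩ else 0) else 0 := by
    rw [Finset.sum_range]
    refine Finset.sum_congr rfl fun x _ => ?_
    by_cases hx : x.val < i.val
    · rw [if_pos (show x < i from hx), if_pos hx, dif_pos x.2]
    · rw [if_neg (show ¬ x < i from hx), if_neg hx]
  simp only
  rw [e1, e2, ← Finset.sum_filter]
  refine Finset.sum_congr ?_ fun _ _ => rfl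
  ext x
  simp only [Finset.mem_range, Finset.mem_filter]
  have := i.2
  omega

/-- Nested blocks. -/
theorem finSigma_assoc {n : ℕ} {k : Fin n → ℕ} (p : ∀ i, Fin (k i) → ℕ)
    (i : Fin n) (j : Fin (k i)) (c : ℕ) (h1 : c < p i j)
    (h1' : c < p (finSigmaFinEquiv.symm (finSigmaFinEquiv (n := k) ⟨i, j⟩)).1
      (finSigmaFinEquiv.symm (finSigmaFinEquiv (n := k) ⟨i, j⟩)).2) :
    (finSigmaFinEquiv (n := fun a => p (finSigmaFinEquiv.symm a).1 (finSigmaFinEquiv.symm a).2)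
      ⟨finSigmaFinEquiv (n := k) ⟨i, j⟩, ⟨c, h1'⟩⟩).val =
    (finSigmaFinEquiv (n := fun i => ∑ j, p i j)
      ⟨i, finSigmaFinEquiv (n := p i) ⟨j, ⟨c, h1⟩⟩⟩).val := by
  rw [finSigma_val, finSigma_val, finSigma_val, ← add_assoc]
  congr 1
  rw [← Equiv.sum_comp (finSigmaFinEquiv (n := k)), Fintype.sum_sigma]
  have hi : (∑ x, if x < j then p i x else 0) =
      ∑ y, if y = i then (∑ x, if (⟨i, x⟩ : Σ i, Fin (k i)).2 < j then p i x else 0) else 0 := by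
    simp
  have hp : ∀ q : Σ i, Fin (k i), p (finSigmaFinEquiv.symm (finSigmaFinEquiv q)).1
      (finSigmaFinEquiv.symm (finSigmaFinEquiv q)).2 = p q.1 q.2 := fun q =>
    congrArg (fun r : Σ i, Fin (k i) => p r.1 r.2) (Equiv.symm_apply_apply _ q)
  rw [hi, ← Finset.sum_add_distrib]
  refine Finset.sum_congr rfl fun y _ => ?_
  simp only [hp, finSigma_lt]
  rcases lt_trichotomy y i with h | h | h
  · simp [h, h.ne]
  · subst h; simp
  · simp [h.asymm, h.ne']

/-! ### Action operads -/

/-- Transport along an equality of indices. -/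
def castIdx {A : ℕ → Type w} {m n : ℕ} (h : m = n) (x : A m) : A n := h ▸ x

/-- An action operad. Equations between operations whose arities are only propositionally equal
are stated in the total space `Σ n, Λ(n)`. -/
structure ActionOperad where
  /-- the sets `Λ(n)` -/
  carrier : ℕ → Type w
  [group : ∀ n, Group (carrier n)]
  /-- the operad unit -/
  unit : carrier 1
  /-- the operad multiplication `μ : Λ(n) × Λ(k₁) × ⋯ × Λ(kₙ) → Λ(k₁ + ⋯ + kₙ)` -/
  mul : ∀ {n : ℕ} {k : Fin n → ℕ}, carrier n → (∀ i, carrier (k i)) → carrier (∑ i, k i)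
  unit_mul : ∀ {n : ℕ} (g : carrier n),
    (⟨_, mul unit fun _ : Fin 1 => g⟩ : Σ n, carrier n) = ⟨n, g⟩
  mul_unit : ∀ {n : ℕ} (g : carrier n),
    (⟨_, mul g fun _ : Fin n => unit⟩ : Σ n, carrier n) = ⟨n, g⟩
  mul_assoc : ∀ {n : ℕ} {k : Fin n → ℕ} {p : ∀ i, Fin (k i) → ℕ} (f : carrier n)
    (g : ∀ i, carrier (k i)) (h : ∀ i j, carrier (p i j)),
    (⟨_, mul (mul f g) fun a =>
        h (finSigmaFinEquiv.symm a).1 (finSigmaFinEquiv.symm a).2⟩ : Σ n, carrier n) =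
      ⟨_, mul f fun i => mul (g i) (h i)⟩
  /-- the group homomorphisms to the symmetric groups -/
  pi : ∀ n, carrier n →* Equiv.Perm (Fin n)
  pi_unit : pi 1 unit = 1
  pi_mul : ∀ {n : ℕ} {k : Fin n → ℕ} (g : carrier n) (f : ∀ i, carrier (k i)),
    pi _ (mul g f) = blockPerm (pi n g) fun i => pi (k i) (f i)
  /-- `μ(g; f₁, …, fₙ) μ(g'; f'₁, …, f'ₙ) = μ(gg'; f_{π(g')(1)} f'₁, …, f_{π(g')(n)} f'ₙ)` whenever
  `f'ᵢ ∈ Λ(kᵢ)` and `fⱼ ∈ Λ(k'ⱼ)` with `k'ⱼ = k_{π(g')⁻¹(j)}`. -/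
  mul_mul : ∀ {n : ℕ} {k k' : Fin n → ℕ} (g g' : carrier n) (f : ∀ j, carrier (k' j))
    (f' : ∀ i, carrier (k i)) (hk : ∀ i, k' (pi n g' i) = k i),
    castIdx (sum_reindex (pi n g') hk) (mul g f) * mul g' f' =
      mul (g * g') fun i => castIdx (hk i) (f (pi n g' i)) * f' i

attribute [instance] ActionOperad.group

theorem castIdx_perm_apply {m n : ℕ} (h : m = n) (σ : Equiv.Perm (Fin m)) (a : Fin n) :
    ((castIdx (A := fun n => Equiv.Perm (Fin n)) h σ) a).val = (σ (Fin.cast h.symm a)).val := by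
  subst h; rfl

theorem perm_total_ext {m n : ℕ} (h : m = n) (σ : Equiv.Perm (Fin m)) (τ : Equiv.Perm (Fin n))
    (H : ∀ a : Fin m, (σ a).val = (τ (Fin.cast h a)).val) :
    (⟨m, σ⟩ : Σ n, Equiv.Perm (Fin n)) = ⟨n, τ⟩ := by
  subst h
  obtain rfl : σ = τ := Equiv.ext fun a => Fin.ext (H a)
  rfl

/-- The symmetric groups as an action operad, with `π` the identity. -/
def symmOperad : ActionOperad.{0} where
  carrier n := Equiv.Perm (Fin n)
  unit := 1
  mul σ τ := blockPerm σ τ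
  unit_mul {n} g := by
    refine perm_total_ext (by simp) _ _ fun a => ?_
    obtain ⟨⟨i, a⟩, rfl⟩ := (finSigmaFinEquiv (n := fun _ : Fin 1 => n)).surjective a
    rw [blockPerm_apply (k' := fun _ => n) _ _ (fun _ => rfl)]
    rw [finSigmaFinEquiv_one]
    simp only [Fin.val_cast]
    congr 2
    ext
    simp
  mul_unit {n} g := by
    refine perm_total_ext (by simp) _ _ fun a => ?_
    obtain ⟨⟨i, a⟩, rfl⟩ := (finSigmaFinEquiv (n := fun _ : Fin n => 1)).surjective a
    rw [blockPerm_apply (k' := fun _ => 1) _ _ (fun _ => rfl)]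
    rw [finSigmaFinEquiv_apply]
    simp
    congr 2
    ext
    simp [finSigmaFinEquiv_apply]
  mul_assoc {n k p} f g h := by
    refine perm_total_ext (sum_blocks p) _ _ fun a => ?_
    obtain ⟨⟨b, c⟩, rfl⟩ := (finSigmaFinEquiv (n := fun a => p (finSigmaFinEquiv.symm a).1
      (finSigmaFinEquiv.symm a).2)).surjective a
    obtain ⟨⟨i, j⟩, rfl⟩ := (finSigmaFinEquiv (n := k)).surjective b
    have hs : finSigmaFinEquiv.symm (finSigmaFinEquiv (n := k) ⟨i, j⟩) = ⟨i, j⟩ :=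
      Equiv.symm_apply_apply _ _
    have hc : c.val < p i j := by
      exact c.2.trans_eq (congrArg (fun r : Σ i, Fin (k i) => p r.1 r.2) hs)
    -- the family of lengths after permuting
    let k' : Fin n → ℕ := fun i' => k (f.symm i')
    let p' : ∀ i', Fin (k' i') → ℕ := fun i' j' => p (f.symm i') ((g (f.symm i')).symm j')
    have hk' : ∀ i, k' (f i) = k i := fun i => by simp [k']
    have hp' : ∀ (i : Fin n) (j : Fin (k i)),
        p' (f i) (Fin.cast (hk' i).symm (g i j)) = p i j := by
      intro i j
      have : ∀ (i₁ : Fin n) (e : i₁ = i) (y : Fin (k i₁)) (_ : y.val = (g i j).val),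
          p i₁ ((g i₁).symm y) = p i j := by
        rintro _ rfl y hy
        obtain rfl : y = g _ j := Fin.ext hy
        simp
      exact this _ (by simp) _ rfl
    have hv : ∀ (x : Σ i, Fin (k i)) (_ : x = ⟨i, j⟩) (y : Fin (p x.1 x.2)) (_ : y.val = c.val),
        (h x.1 x.2 y).val = (h i j ⟨c, hc⟩).val := by
      rintro _ rfl y hy
      obtain rfl : y = ⟨c, hc⟩ := Fin.ext hy
      rfl
    have hsum := sum_reindex f hk'
    have hb : ∀ b : Fin (∑ i, k i), Fin.cast hsum.symm (blockPerm f g b) =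
        finSigmaFinEquiv (n := k') ⟨f (finSigmaFinEquiv.symm b).1,
          Fin.cast (hk' _).symm (g _ (finSigmaFinEquiv.symm b).2)⟩ := by
      intro b
      obtain ⟨x, rfl⟩ := (finSigmaFinEquiv (n := k)).surjective b
      rw [Equiv.symm_apply_apply]
      ext
      exact blockPerm_apply f g hk' x.1 x.2
    let q : Fin (∑ i, k' i) → ℕ := fun b' =>
      p' (finSigmaFinEquiv.symm b').1 (finSigmaFinEquiv.symm b').2
    have hq : ∀ b : Fin (∑ i, k i), q (Fin.cast hsum.symm (blockPerm f g b)) =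
        p (finSigmaFinEquiv.symm b).1 (finSigmaFinEquiv.symm b).2 := by
      intro b
      have := congrArg (fun r : Σ i', Fin (k' i') => p' r.1 r.2)
        ((finSigmaFinEquiv (n := k')).symm_apply_apply ⟨f (finSigmaFinEquiv.symm b).1,
          Fin.cast (hk' _).symm (g _ (finSigmaFinEquiv.symm b).2)⟩)
      rw [hb]
      exact this.trans (hp' _ _)
    rw [blockPerm_apply (k' := fun b' => q (Fin.cast hsum.symm b')) _ _ hq]
    have e1 : Fin.cast (sum_blocks p) (finSigmaFinEquiv ⟨finSigmaFinEquiv ⟨i, j⟩, c⟩) =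
        finSigmaFinEquiv (n := fun i => ∑ j, p i j)
          ⟨i, finSigmaFinEquiv (n := p i) ⟨j, ⟨c, hc⟩⟩⟩ := by
      ext
      exact finSigma_assoc p i j c hc _
    rw [e1]
    have hP : ∀ i, ∑ j, p' (f i) j = ∑ j, p i j := by
      intro i
      rw [← Equiv.sum_comp (finCongr (hk' i).symm), ← Equiv.sum_comp (g i)]
      exact Finset.sum_congr rfl fun j _ => hp' i j
    rw [blockPerm_apply (k' := fun i' => ∑ j, p' i' j) _ _ hP]
    have hlt : (h i j ⟨c, hc⟩).val < p' (f i) (Fin.cast (hk' i).symm (g i j)) := by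
      rw [hp']; exact (h i j ⟨c, hc⟩).2
    refine Eq.trans (finSigma_val_congr (l := q)
      (q := ⟨finSigmaFinEquiv (n := k') ⟨f i, Fin.cast (hk' i).symm (g i j)⟩,
        ⟨(h i j ⟨c, hc⟩).val, ?_⟩⟩) hsum.symm ?_ ?_ ?_) ((finSigma_assoc p' _ _ _ hlt _).trans ?_)
    · intro x y hxy
      obtain rfl : Fin.cast hsum.symm x = y := Fin.ext hxy
      rfl
    · have := congrArg (fun r : Σ i', Fin (k' i') => p' r.1 r.2)
        ((finSigmaFinEquiv (n := k')).symm_apply_apply ⟨f i, Fin.cast (hk' i).symm (g i j)⟩)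
      exact hlt.trans_eq this.symm
    · exact blockPerm_apply f g hk' i j
    · exact hv _ hs _ rfl
    · refine finSigma_val_congr rfl (by rintro x y hxy; rw [Fin.ext hxy]) rfl ?_
      simp only [Fin.val_cast]
      refine Eq.trans ?_ (blockPerm_apply (k' := fun y => p' (f i) (Fin.cast (hk' i).symm y))
        (g i) (h i) (hp' i) j ⟨c, hc⟩).symm
      refine finSigma_val_congr (hk' i) ?_ rfl rfl
      intro x y hxy
      obtain rfl : Fin.cast (hk' i) x = y := Fin.ext hxy
      rfl
  pi n := MonoidHom.id _
  pi_unit := rfl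
  pi_mul _ _ := rfl
  mul_mul {n k k'} g g' f f' hk := by
    ext a
    obtain ⟨⟨i, a⟩, rfl⟩ := (finSigmaFinEquiv (n := k)).surjective a
    rw [Equiv.Perm.mul_apply, castIdx_perm_apply]
    have h1 : Fin.cast (sum_reindex g' hk).symm (blockPerm g' f' (finSigmaFinEquiv ⟨i, a⟩)) =
        finSigmaFinEquiv (n := k') ⟨g' i, Fin.cast (hk i).symm (f' i a)⟩ := by
      ext; exact blockPerm_apply g' f' hk i a
    erw [h1]
    rw [blockPerm_apply (k' := fun j => k' (g.symm j)) _ _ (by simp),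
      blockPerm_apply (k' := fun j => k' (g.symm j)) _ _ (by simpa using hk)]
    refine finSigma_val_congr rfl (fun x y hxy => by rw [Fin.ext hxy]) rfl ?_
    simp only [Fin.val_cast, Equiv.Perm.mul_apply]
    exact (castIdx_perm_apply (hk i) (f (g' i)) (f' i a)).symm

/-! ### The categorical Borel construction -/

theorem total_eq_iff {A : ℕ → Type w} {m n : ℕ} {x : A m} {y : A n} :
    (⟨m, x⟩ : Σ n, A n) = ⟨n, y⟩ ↔ ∃ h : m = n, castIdx h x = y := by
  constructor
  · intro h; cases h; exact ⟨rfl, rfl⟩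
  · rintro ⟨rfl, rfl⟩; rfl

namespace ActionOperad

theorem pi_castIdx (Λ : ActionOperad.{w}) {m n : ℕ} (h : m = n) (g : Λ.carrier m) (a : Fin n) :
    (Λ.pi n (castIdx h g) a).val = (Λ.pi m g (Fin.cast h.symm a)).val := by
  subst h; rfl

theorem castIdx_mul (Λ : ActionOperad.{w}) {m n : ℕ} (h : m = n) (g g' : Λ.carrier m) :
    castIdx h (g * g') = castIdx h g * castIdx h g' := by
  subst h; rfl

theorem castIdx_one (Λ : ActionOperad.{w}) {m n : ℕ} (h : m = n) :
    castIdx h (1 : Λ.carrier m) = 1 := by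
  subst h; rfl

theorem mul_one_one (Λ : ActionOperad.{w}) {n : ℕ} {k : Fin n → ℕ} :
    Λ.mul (1 : Λ.carrier n) (fun i => (1 : Λ.carrier (k i))) = 1 := by
  have h := Λ.mul_mul (k := k) (k' := k) (1 : Λ.carrier n) 1 (fun _ => 1) (fun _ => 1)
    (fun i => by simp)
  have h2 : ∀ i, castIdx (A := Λ.carrier) (show k (Λ.pi n 1 i) = k i by simp) 1 * 1 = 1 := by
    intro i; rw [castIdx_one, _root_.mul_one]
  simp only [h2] at h
  rw [_root_.mul_one] at h
  exact mul_eq_right.mp h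

/-- The operad unit is the neutral element of `Λ(1)`. -/
theorem unit_eq_one (Λ : ActionOperad.{w}) : Λ.unit = 1 := by
  have e1 := Λ.unit_mul (1 : Λ.carrier 1)
  have e2 := Λ.mul_unit (1 : Λ.carrier 1)
  have h := Λ.mul_mul (k := fun _ : Fin 1 => 1) (k' := fun _ : Fin 1 => 1)
    Λ.unit 1 (fun _ => 1) (fun _ => Λ.unit) (fun _ => rfl)
  obtain ⟨p1, e1⟩ := total_eq_iff.mp e1
  obtain ⟨p2, e2⟩ := total_eq_iff.mp e2
  have e3 := Λ.mul_unit Λ.unit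
  obtain ⟨p3, e3⟩ := total_eq_iff.mp e3
  have h := congrArg (castIdx p3) h
  rw [castIdx_mul] at h
  change castIdx p3 (Λ.mul Λ.unit fun _ => 1) * castIdx p3 (Λ.mul 1 fun _ => Λ.unit) = _ at h
  rw [e1, e2] at h
  have h4 : (Λ.mul (Λ.unit * 1) fun i : Fin 1 => castIdx (A := Λ.carrier) rfl 1 * Λ.unit) =
      Λ.mul Λ.unit fun _ : Fin 1 => Λ.unit := by
    congr 1
    · simp
    · funext i; exact _root_.one_mul _
  rw [_root_.one_mul] at h
  exact (h.trans ((congrArg (castIdx p3) h4).trans e3)).symm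

end ActionOperad

/-- Objects of `EΛ(X)`: the class `[e; x₁, …, xₙ]` is represented by the tuple `(x₁, …, xₙ)`. As
`[g; x₁, …, xₙ] = [e; x_{π(g)⁻¹(1)}, …, x_{π(g)⁻¹(n)}]`, every class has exactly one such
representative. -/
@[ext]
structure BorelCat (Λ : ActionOperad.{w}) (X : Type u) : Type u where
  len : ℕ
  pt : Fin len → X

namespace BorelCat

variable {Λ : ActionOperad.{w}}

section
variable {X : Type u} [Category.{v} X]

/-- Morphisms `[e; x₁, …, xₙ] ⟶ [e; y₁, …, yₙ]` of `EΛ(X)`: an element `g ∈ Λ(n)` with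
morphisms `fᵢ : xᵢ ⟶ y_{π(g)(i)}`; it is the class of
`(!; f₁, …, fₙ) : (e; x₁, …, xₙ) ⟶ (g; y_{π(g)(1)}, …, y_{π(g)(n)})`. The morphism `fᵢ` is
given as `map i j h`, where `h` says that `j = π(g)(i)`. -/
structure Hom (p q : BorelCat Λ X) : Type (max w v) where
  len_eq : p.len = q.len
  elt : Λ.carrier p.len
  map : ∀ (i : Fin p.len) (j : Fin q.len), j.val = (Λ.pi _ elt i).val → (p.pt i ⟶ q.pt j)

theorem Hom.ext' {p q : BorelCat Λ X} {φ ψ : Hom p q} (h : φ.elt = ψ.elt)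
    (hm : ∀ i j h1 h2, φ.map i j h1 = ψ.map i j h2) : φ = ψ := by
  obtain ⟨_, g, m⟩ := φ
  obtain ⟨_, g', m'⟩ := ψ
  obtain rfl : g = g' := h
  congr
  funext i j h
  exact hm i j h h

instance : Category (BorelCat Λ X) where
  Hom p q := Hom p q
  id p := ⟨rfl, 1, fun i j h => eqToHom (by
    obtain rfl : j = i := Fin.ext (by simpa using h)
    rfl)⟩
  comp {p q r} φ ψ := ⟨φ.len_eq.trans ψ.len_eq, castIdx φ.len_eq.symm ψ.elt * φ.elt,
    fun i k h => φ.map i (Fin.cast φ.len_eq (Λ.pi _ φ.elt i)) rfl ≫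
      ψ.map (Fin.cast φ.len_eq (Λ.pi _ φ.elt i)) k (by
        rw [h, map_mul, Equiv.Perm.mul_apply, Λ.pi_castIdx])⟩
  id_comp {p q} φ := by
    refine Hom.ext' (_root_.mul_one _) fun i j h1 h2 => ?_
    have : ∀ (i' : Fin p.len) (e : i = i') (h : j.val = (Λ.pi _ φ.elt i').val),
        eqToHom (by rw [e]) ≫ φ.map i' j h = φ.map i j h2 := by
      rintro _ rfl h; simp
    exact this _ (by ext; simp) _
  comp_id {p q} φ := by
    obtain ⟨n, x⟩ := p
    obtain ⟨m, y⟩ := q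
    obtain rfl : n = m := φ.len_eq
    refine Hom.ext' (_root_.one_mul _) fun i j h1 h2 => ?_
    have : ∀ (j' : Fin n) (e : j' = j) (h : j'.val = (Λ.pi _ φ.elt i).val),
        φ.map i j' h ≫ eqToHom (by rw [e]) = φ.map i j h2 := by
      rintro _ rfl h; simp
    exact this _ (Fin.ext h2.symm) _
  assoc {p q r s} φ ψ χ := by
    obtain ⟨n, x⟩ := p
    obtain ⟨m, y⟩ := q
    obtain ⟨k, z⟩ := r
    obtain ⟨l, t⟩ := s
    obtain rfl : n = m := φ.len_eq
    obtain rfl : n = k := ψ.len_eq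
    obtain rfl : n = l := χ.len_eq
    refine Hom.ext' (_root_.mul_assoc _ _ _).symm fun i j h1 h2 => ?_
    have : ∀ (a b : Fin n) (e : a = b) h h' h'' h''', ψ.map (Λ.pi _ φ.elt i) a h ≫ χ.map a j h' =
      ψ.map (Λ.pi _ φ.elt i) b h'' ≫ χ.map b j h''' := by
      rintro a _ rfl _ _ _ _; rfl
    change (_ ≫ _) ≫ _ = _ ≫ _ ≫ _
    rw [Category.assoc]
    congr 1
    refine this _ _ ?_ _ _ _ _
    simp [castIdx]

theorem id_elt (p : BorelCat Λ X) : Hom.elt (𝟙 p) = 1 := rfl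

theorem id_map (p : BorelCat Λ X) (i : Fin p.len) (h) : Hom.map (𝟙 p) i i h = 𝟙 _ := rfl

theorem comp_elt {p q r : BorelCat Λ X} (φ : p ⟶ q) (ψ : q ⟶ r) :
    Hom.elt (φ ≫ ψ) = castIdx (Hom.len_eq φ).symm (Hom.elt ψ) * Hom.elt φ := rfl

theorem comp_map {p q r : BorelCat Λ X} (φ : p ⟶ q) (ψ : q ⟶ r) (i : Fin p.len) (j : Fin q.len)
    (k : Fin r.len) (h1) (h2) (h3) :
    Hom.map (φ ≫ ψ) i k h1 = Hom.map φ i j h2 ≫ Hom.map ψ j k h3 := by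
  obtain rfl : j = Fin.cast (Hom.len_eq φ) (Λ.pi _ (Hom.elt φ) i) := Fin.ext h2
  rfl

theorem map_congr {p q : BorelCat Λ X} {φ ψ : p ⟶ q} (h : φ = ψ) (i : Fin p.len) (j : Fin q.len)
    (h1) : Hom.map φ i j h1 = Hom.map ψ i j (h ▸ h1) := by
  subst h; rfl

theorem obj_ext {p q : BorelCat Λ X} (h : p.len = q.len)
    (hx : ∀ i, p.pt i = q.pt (Fin.cast h i)) : p = q := by
  obtain ⟨n, x⟩ := p
  obtain ⟨m, y⟩ := q
  obtain rfl : n = m := h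
  obtain rfl : x = y := funext hx
  rfl

theorem hom_heq {p q p' q' : BorelCat Λ X} (hp : p = p') (hq : q = q') {φ : p ⟶ q} {ψ : p' ⟶ q'}
    (he : ∃ h : p.len = p'.len, castIdx h (Hom.elt φ) = Hom.elt ψ)
    (hm : ∀ i j i' j' h h', i.val = i'.val → j.val = j'.val →
      HEq (Hom.map φ i j h) (Hom.map ψ i' j' h')) : HEq φ ψ := by
  subst hp; subst hq
  obtain ⟨_, he⟩ := he
  exact heq_of_eq (Hom.ext' he fun i j h1 h2 => eq_of_heq (hm i j i j h1 h2 rfl rfl))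

end

section
variable {X : Type u} [Category.{v} X] {Y : Type u'} [Category.{v'} Y]

/-- The functor `EΛ(F)`. -/
def mapFunctor (F : X ⥤ Y) : BorelCat Λ X ⥤ BorelCat Λ Y where
  obj p := ⟨p.len, fun i => F.obj (p.pt i)⟩
  map {p q} φ := ⟨Hom.len_eq (p := p) (q := q) φ, Hom.elt (p := p) (q := q) φ,
    fun i j h => F.map (Hom.map (p := p) (q := q) φ i j h)⟩
  map_id p := Hom.ext' rfl fun i j h _ => by
    obtain rfl : j = i := Fin.ext (by simpa [id_elt] using h)
    exact F.map_id _
  map_comp φ ψ := Hom.ext' rfl fun i j h _ => F.map_comp _ _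

/-- The unit `x ↦ [e; x]`. -/
def unitFunctor (Λ : ActionOperad.{w}) (X : Type u) [Category.{v} X] : X ⥤ BorelCat Λ X where
  obj x := ⟨1, fun _ => x⟩
  map f := ⟨rfl, 1, fun _ _ _ => f⟩
  map_id _ := Hom.ext' rfl fun _ _ _ _ => rfl
  map_comp _ _ := Hom.ext' (_root_.mul_one _).symm fun _ _ _ _ => rfl

/-- Concatenation of tuples of tuples. -/
def flat (p : BorelCat Λ (BorelCat Λ X)) : BorelCat Λ X :=
  ⟨∑ i, (p.pt i).len, fun a => (p.pt (finSigmaFinEquiv.symm a).1).pt (finSigmaFinEquiv.symm a).2⟩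

/-- The group elements in the components of a morphism of `EΛ(EΛ(X))`. -/
def innerElt {p q : BorelCat Λ (BorelCat Λ X)} (φ : p ⟶ q) (i : Fin p.len) :
    Λ.carrier (p.pt i).len :=
  Hom.elt (Hom.map φ i (Fin.cast (Hom.len_eq φ) (Λ.pi _ (Hom.elt φ) i)) rfl)

theorem innerElt_eq {p q : BorelCat Λ (BorelCat Λ X)} (φ : p ⟶ q) (i : Fin p.len) (j : Fin q.len)
    (h) : innerElt φ i = Hom.elt (Hom.map φ i j h) := by
  obtain rfl : j = Fin.cast (Hom.len_eq φ) (Λ.pi _ (Hom.elt φ) i) := Fin.ext h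
  rfl

theorem inner_len {p q : BorelCat Λ (BorelCat Λ X)} (φ : p ⟶ q) (i : Fin p.len) :
    (q.pt (Fin.cast (Hom.len_eq φ) (Λ.pi _ (Hom.elt φ) i))).len = (p.pt i).len :=
  (Hom.len_eq (Hom.map φ i (Fin.cast (Hom.len_eq φ) (Λ.pi _ (Hom.elt φ) i)) rfl)).symm

theorem flat_len {p q : BorelCat Λ (BorelCat Λ X)} (φ : p ⟶ q) : (flat p).len = (flat q).len := by
  have h : ∑ j : Fin p.len, (q.pt (Fin.cast (Hom.len_eq φ) j)).len = ∑ i, (p.pt i).len :=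
    sum_reindex (Λ.pi _ (Hom.elt φ)) (inner_len φ)
  exact h.symm.trans (Equiv.sum_comp (finCongr (Hom.len_eq φ)) fun j => (q.pt j).len)

theorem flat_index {p q : BorelCat Λ (BorelCat Λ X)} (φ : p ⟶ q) (i : Fin p.len)
    (a : Fin (p.pt i).len) (j : Fin q.len) (b : Fin (q.pt j).len) :
    (finSigmaFinEquiv (n := fun j => (q.pt j).len) ⟨j, b⟩).val =
      (Λ.pi _ (Λ.mul (Hom.elt φ) (innerElt φ)) (finSigmaFinEquiv ⟨i, a⟩)).val ↔
    j.val = (Λ.pi _ (Hom.elt φ) i).val ∧ b.val = (Λ.pi _ (innerElt φ i) a).val := by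
  rw [Λ.pi_mul, blockPerm_apply (k' := fun j => (q.pt (Fin.cast (Hom.len_eq φ) j)).len) _ _
    (inner_len φ)]
  have key : ∀ x y : Fin p.len, x = y →
      (q.pt (Fin.cast (Hom.len_eq φ) x)).len = (q.pt (Fin.cast (Hom.len_eq φ) y)).len := by
    rintro x _ rfl; rfl
  constructor
  · intro h
    exact finSigma_val_inj (Hom.len_eq φ).symm (by
      rintro x y hxy
      obtain rfl : x = Fin.cast (Hom.len_eq φ) y := Fin.ext hxy
      rfl) h
  · rintro ⟨h1, h2⟩
    exact finSigma_val_congr (Hom.len_eq φ).symm (by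
      rintro x y hxy
      obtain rfl : x = Fin.cast (Hom.len_eq φ) y := Fin.ext hxy
      rfl) h1 h2

theorem flat_index' {p q : BorelCat Λ (BorelCat Λ X)} (φ : p ⟶ q) (a : Fin (flat p).len)
    (b : Fin (flat q).len)
    (h : b.val = (Λ.pi _ (Λ.mul (Hom.elt φ) (innerElt φ)) a).val) :
    (finSigmaFinEquiv.symm b).1.val = (Λ.pi _ (Hom.elt φ) (finSigmaFinEquiv.symm a).1).val ∧
      (finSigmaFinEquiv.symm b).2.val =
        (Λ.pi _ (innerElt φ (finSigmaFinEquiv.symm a).1) (finSigmaFinEquiv.symm a).2).val := by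
  refine (flat_index φ _ _ _ _).mp ?_
  exact (congrArg Fin.val (Equiv.apply_symm_apply finSigmaFinEquiv b)).trans (h.trans
    (congrArg (fun a => (Λ.pi _ (Λ.mul (Hom.elt φ) (innerElt φ)) a).val)
      (Equiv.apply_symm_apply finSigmaFinEquiv a).symm))

/-- The morphism part of the multiplication: a morphism of `EΛ(EΛ(X))` given by `g` and, at the
place `i`, by `hᵢ` and morphisms `fᵢⱼ`, is sent to the morphism given by `μ(g; h₁, …, hₙ)` and the
`fᵢⱼ`. -/
def flatHom {p q : BorelCat Λ (BorelCat Λ X)} (φ : p ⟶ q) : flat p ⟶ flat q :=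
  ⟨flat_len φ, Λ.mul (Hom.elt φ) (innerElt φ), fun a b h =>
    Hom.map (Hom.map φ (finSigmaFinEquiv.symm a).1 (finSigmaFinEquiv.symm b).1
        (flat_index' φ a b h).1)
      (finSigmaFinEquiv.symm a).2 (finSigmaFinEquiv.symm b).2
      (by rw [← innerElt_eq]; exact (flat_index' φ a b h).2)⟩

/-- The multiplication `EΛ(EΛ(X)) ⥤ EΛ(X)`. -/
def multFunctor (Λ : ActionOperad.{w}) (X : Type u) [Category.{v} X] :
    BorelCat Λ (BorelCat Λ X) ⥤ BorelCat Λ X where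
  obj := flat
  map := flatHom
  map_id p := by
    refine Hom.ext' ?_ fun a b h1 h2 => ?_
    · have : innerElt (𝟙 p) = fun i => 1 := by
        funext i
        rw [innerElt_eq (𝟙 p) i i (by simp [id_elt]), id_map, id_elt]
      change Λ.mul 1 (innerElt (𝟙 p)) = 1
      rw [this, Λ.mul_one_one]
    · obtain rfl : b = a := Fin.ext (by simpa [id_elt] using h2)
      rfl
  map_comp {p q r} φ ψ := by
    refine Hom.ext' ?_ fun a b h1 h2 => ?_
    · obtain ⟨n, x⟩ := p
      obtain ⟨m, y⟩ := q
      obtain ⟨k, z⟩ := r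
      obtain rfl : n = m := Hom.len_eq φ
      obtain rfl : n = k := Hom.len_eq ψ
      have h := Λ.mul_mul (n := n) (Hom.elt ψ) (Hom.elt φ) (innerElt ψ) (innerElt φ) (inner_len φ)
      refine Eq.trans ?_ h.symm
      change Λ.mul (n := n) (Hom.elt (p := ⟨n, y⟩) (q := ⟨n, z⟩) ψ *
        Hom.elt (p := ⟨n, x⟩) (q := ⟨n, y⟩) φ) (innerElt (φ ≫ ψ)) = _
      congr 1
      funext i
      rw [innerElt_eq (φ ≫ ψ) i (Λ.pi _ (Hom.elt ψ) (Λ.pi _ (Hom.elt φ) i))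
        (by rw [comp_elt]; simp [castIdx])]
      rw [comp_map φ ψ i (Λ.pi _ (Hom.elt φ) i) _ _ rfl rfl, comp_elt]
      rfl
    · have hb : b.val = (Λ.pi _ (Hom.elt (flatHom ψ)) (Fin.cast (flat_len φ)
          (Λ.pi _ (Hom.elt (flatHom φ)) a))).val := by
        rw [h2, comp_elt, map_mul, Equiv.Perm.mul_apply, Λ.pi_castIdx]
      have e := comp_map φ ψ _ _ _ (flat_index' (φ ≫ ψ) a b h1).1
        (flat_index' φ a (Fin.cast (flat_len φ) (Λ.pi _ (Hom.elt (flatHom φ)) a)) rfl).1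
        (flat_index' ψ _ b hb).1
      have hd := (flat_index' (φ ≫ ψ) a b h1).2
      rw [innerElt_eq _ _ _ (flat_index' (φ ≫ ψ) a b h1).1] at hd
      exact (map_congr e _ _ hd).trans (comp_map _ _ _ (finSigmaFinEquiv.symm
        (Fin.cast (flat_len φ) (Λ.pi _ (Hom.elt (flatHom φ)) a))).2 _ _ _ _)

end

section
variable (Λ : ActionOperad.{w})

theorem unit_natural {X Y : Type u} [Category.{v} X] [Category.{v} Y] (F : X ⥤ Y) :
    F ⋙ unitFunctor Λ Y = unitFunctor Λ X ⋙ mapFunctor F := rfl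

theorem mult_natural {X Y : Type u} [Category.{v} X] [Category.{v} Y] (F : X ⥤ Y) :
    mapFunctor (mapFunctor F) ⋙ multFunctor Λ Y = multFunctor Λ X ⋙ mapFunctor F := rfl

theorem mult_unit (X : Type u) [Category.{v} X] :
    unitFunctor Λ (BorelCat Λ X) ⋙ multFunctor Λ X = 𝟭 (BorelCat Λ X) := by
  have hidx : ∀ (n : ℕ) (a : Fin (∑ _ : Fin 1, n)),
      (finSigmaFinEquiv (n := fun _ : Fin 1 => n).symm a).2.val = a.val := by
    intro n a
    rw [← finSigmaFinEquiv_one, Equiv.apply_symm_apply]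
  have hobj : ∀ p : BorelCat Λ X, (unitFunctor Λ (BorelCat Λ X) ⋙ multFunctor Λ X).obj p = p := by
    intro p
    exact obj_ext (by simp [unitFunctor, multFunctor, flat]) fun a =>
      congrArg p.pt (Fin.ext (hidx p.len a))
  refine Functor.hext hobj fun p q φ => hom_heq (hobj p) (hobj q) ?_ ?_
  · have := Λ.unit_mul (Hom.elt φ)
    rw [Λ.unit_eq_one] at this
    exact total_eq_iff.mp this
  · intro i j i' j' h h' hi hj
    obtain rfl := (Fin.ext ((hidx p.len i).trans hi) : _ = i')
    obtain rfl := (Fin.ext ((hidx q.len j).trans hj) : _ = j')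
    rfl

theorem mult_map_unit (X : Type u) [Category.{v} X] :
    mapFunctor (unitFunctor Λ X) ⋙ multFunctor Λ X = 𝟭 (BorelCat Λ X) := by
  have hidx : ∀ (n : ℕ) (a : Fin (∑ _ : Fin n, 1)),
      (finSigmaFinEquiv (n := fun _ : Fin n => 1).symm a).1.val = a.val := by
    intro n a
    obtain ⟨⟨i, c⟩, rfl⟩ := (finSigmaFinEquiv (n := fun _ : Fin n => 1)).surjective a
    rw [Equiv.symm_apply_apply, finSigmaFinEquiv_apply]
    simp
  have hobj : ∀ p : BorelCat Λ X,
      (mapFunctor (unitFunctor Λ X) ⋙ multFunctor Λ X).obj p = p := by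
    intro p
    exact obj_ext (by simp [unitFunctor, multFunctor, flat, mapFunctor]) fun a =>
      congrArg p.pt (Fin.ext (hidx p.len a))
  refine Functor.hext hobj fun p q φ => hom_heq (hobj p) (hobj q) ?_ ?_
  · have := Λ.mul_unit (Hom.elt φ)
    rw [Λ.unit_eq_one] at this
    exact total_eq_iff.mp this
  · intro i j i' j' h h' hi hj
    obtain rfl := (Fin.ext ((hidx p.len i).trans hi) : _ = i')
    obtain rfl := (Fin.ext ((hidx q.len j).trans hj) : _ = j')
    rfl

theorem triple_eq {n : ℕ} {k : Fin n → ℕ} (p : ∀ i, Fin (k i) → ℕ) (a : Fin (∑ i, ∑ j, p i j))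
    (a' : Fin (∑ b, p (finSigmaFinEquiv.symm b).1 (finSigmaFinEquiv.symm b).2))
    (h : a.val = a'.val) :
    (⟨(finSigmaFinEquiv.symm a).1, (finSigmaFinEquiv.symm (finSigmaFinEquiv.symm a).2).1,
      (finSigmaFinEquiv.symm (finSigmaFinEquiv.symm a).2).2⟩ : Σ i, Σ j, Fin (p i j)) =
    ⟨(finSigmaFinEquiv.symm (finSigmaFinEquiv.symm a').1).1,
      (finSigmaFinEquiv.symm (finSigmaFinEquiv.symm a').1).2, (finSigmaFinEquiv.symm a').2⟩ := by
  obtain ⟨⟨b, d⟩, rfl⟩ := (finSigmaFinEquiv (n := fun b =>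
    p (finSigmaFinEquiv.symm b).1 (finSigmaFinEquiv.symm b).2)).surjective a'
  have e2 := congrArg (fun x : Σ b, Fin (p (finSigmaFinEquiv.symm b).1
    (finSigmaFinEquiv.symm b).2) => (⟨(finSigmaFinEquiv.symm x.1).1,
      (finSigmaFinEquiv.symm x.1).2, x.2⟩ : Σ i, Σ j, Fin (p i j)))
    ((finSigmaFinEquiv (n := fun b =>
    p (finSigmaFinEquiv.symm b).1 (finSigmaFinEquiv.symm b).2)).symm_apply_apply ⟨b, d⟩)
  refine Eq.trans ?_ e2.symm
  have hb := (finSigmaFinEquiv (n := k)).apply_symm_apply b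
  have ha : a = finSigmaFinEquiv (n := fun i => ∑ j, p i j) ⟨(finSigmaFinEquiv.symm b).1,
      finSigmaFinEquiv (n := p _) ⟨(finSigmaFinEquiv.symm b).2, d⟩⟩ := by
    ext
    rw [h]
    refine Eq.trans ?_ (finSigma_assoc p _ _ d.val d.2 (by
      refine d.2.trans_eq ?_
      exact congrArg (fun b => p (finSigmaFinEquiv.symm b).1 (finSigmaFinEquiv.symm b).2) hb.symm))
    refine finSigma_val_congr rfl (by rintro x y hxy; rw [Fin.ext hxy]) ?_ rfl
    exact congrArg Fin.val hb.symm
  have e1 := congrArg (fun x : Σ i, Fin (∑ j, p i j) => (⟨x.1, finSigmaFinEquiv.symm x.2⟩ :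
    Σ i, Σ j, Fin (p i j))) ((congrArg finSigmaFinEquiv.symm ha).trans
      (Equiv.symm_apply_apply _ _))
  refine e1.trans ?_
  simp

theorem mult_assoc (X : Type u) [Category.{v} X] :
    mapFunctor (multFunctor Λ X) ⋙ multFunctor Λ X =
      multFunctor Λ (BorelCat Λ X) ⋙ multFunctor Λ X := by
  have hobj : ∀ p, (mapFunctor (multFunctor Λ X) ⋙ multFunctor Λ X).obj p =
      (multFunctor Λ (BorelCat Λ X) ⋙ multFunctor Λ X).obj p := by
    intro p
    refine obj_ext (sum_blocks fun i j => ((p.pt i).pt j).len).symm fun a => ?_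
    exact congrArg (fun t : Σ i, Σ j, Fin ((p.pt i).pt j).len => ((p.pt t.1).pt t.2.1).pt t.2.2)
      (triple_eq (fun i j => ((p.pt i).pt j).len) a (Fin.cast (sum_blocks _).symm a) rfl)
  refine Functor.hext hobj fun p q φ => hom_heq (hobj p) (hobj q) ?_ ?_
  · refine total_eq_iff.mp ?_
    have h1 := Λ.mul_assoc (Hom.elt φ) (innerElt φ) (fun i j =>
      innerElt (Hom.map φ i (Fin.cast (Hom.len_eq φ) (Λ.pi _ (Hom.elt φ) i)) rfl) j)
    refine Eq.trans h1.symm ?_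
    let e := finSigmaFinEquiv (n := fun i => (p.pt i).len)
    have h2 : innerElt (flatHom φ) = fun a => innerElt (Hom.map φ (e.symm a).1
        (Fin.cast (Hom.len_eq φ) (Λ.pi _ (Hom.elt φ) (e.symm a).1)) rfl) (e.symm a).2 := by
      funext a
      have hb := flat_index' φ a (Fin.cast (flat_len φ) (Λ.pi _ (Hom.elt (flatHom φ)) a)) rfl
      have key : ∀ (j j' : Fin q.len) (_ : j = j') h h' (c : Fin (q.pt j).len) h'',
          Hom.elt (Hom.map (Hom.map φ (finSigmaFinEquiv.symm a).1 j h)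
            (finSigmaFinEquiv.symm a).2 c h'') =
          innerElt (Hom.map φ (finSigmaFinEquiv.symm a).1 j' h') (finSigmaFinEquiv.symm a).2 := by
        rintro j _ rfl h h' c h''
        exact (innerElt_eq _ _ _ _).symm
      exact key _ _ (Fin.ext hb.1) _ _ _ _
    exact congrArg (fun f => (⟨_, Λ.mul (Λ.mul (Hom.elt φ) (innerElt φ)) f⟩ :
      Σ n, Λ.carrier n)) h2.symm
  · intro a b a' b' h h' ha hb
    have hs := triple_eq (fun i j => ((p.pt i).pt j).len) a a' ha
    have ht := triple_eq (fun i j => ((q.pt i).pt j).len) b b' hb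
    have key : ∀ (s s' : Σ i, Σ j, Fin ((p.pt i).pt j).len)
      (t t' : Σ i, Σ j, Fin ((q.pt i).pt j).len), s = s' → t = t' → ∀ h1 h2 h3 h1' h2' h3',
        HEq (Hom.map (Hom.map (Hom.map φ s.1 t.1 h1) s.2.1 t.2.1 h2) s.2.2 t.2.2 h3)
          (Hom.map (Hom.map (Hom.map φ s'.1 t'.1 h1') s'.2.1 t'.2.1 h2') s'.2.2 t'.2.2 h3') := by
      rintro s _ t _ rfl rfl _ _ _ _ _ _; rfl
    exact key _ _ _ _ hs ht _ _ _ _ _ _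

end
end BorelCat

/-- The monad `EΛ` on the category of small categories,
`X ↦ ∐ₙ EΛ(n) ×_{Λ(n)} Xⁿ`. -/
def borelMonad (Λ : ActionOperad.{w}) : Monad Cat.{max w u, max w u} where
  obj X := Cat.of (BorelCat Λ X)
  map F := (BorelCat.mapFunctor F.toFunctor).toCatHom
  η := { app X := (BorelCat.unitFunctor Λ X).toCatHom }
  μ := { app X := (BorelCat.multFunctor Λ X).toCatHom }
  assoc X := Cat.ext (BorelCat.mult_assoc Λ X)
  left_unit X := Cat.ext (BorelCat.mult_unit Λ X)
  right_unit X := Cat.ext (BorelCat.mult_map_unit Λ X)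

/-! ### Cartesian monads, generalized operads and their induced monads -/

section GeneralizedOperads

variable {C : Type u} [Category.{v} C]

/-- A monad is cartesian if its functor preserves pullbacks and all naturality squares of its unit
and of its multiplication are pullbacks. -/
structure IsCartesianMonad (T : Monad C) : Prop where
  map_isPullback : ∀ {P X Y Z : C} {p : P ⟶ X} {q : P ⟶ Y} {f : X ⟶ Z} {g : Y ⟶ Z},
    IsPullback p q f g → IsPullback (T.map p) (T.map q) (T.map f) (T.map g)
  unit : T.η.Equifibered
  mult : T.μ.Equifibered

variable [HasPullbacks C] (T : Monad C) {t : C} (ht : IsTerminal t)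

/-- For a `T`-collection `x : X ⟶ T1`, the pullback of `x` along `T! : TY ⟶ T1`. -/
noncomputable def collComp {X : C} (x : X ⟶ T.obj t) (Y : C) : C :=
  pullback x (T.map (ht.from Y))

/-- The projection to `X`. -/
noncomputable def collFst {X : C} (x : X ⟶ T.obj t) (Y : C) : collComp T ht x Y ⟶ X :=
  pullback.fst _ _

/-- The projection to `TY`. -/
noncomputable def collSnd {X : C} (x : X ⟶ T.obj t) (Y : C) : collComp T ht x Y ⟶ T.obj Y :=
  pullback.snd _ _

theorem coll_isPullback {X : C} (x : X ⟶ T.obj t) (Y : C) :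
    IsPullback (collFst T ht x Y) (collSnd T ht x Y) x (T.map (ht.from Y)) :=
  IsPullback.of_hasPullback _ _

/-- The structure map `X ∘ Y ⟶ TY ⟶ T²1 ⟶ T1` of the composition product of the `T`-collections
`x : X ⟶ T1` and `y : Y ⟶ T1`; the underlying object of the product is `collComp T ht x Y`. -/
noncomputable def collCompHom {X Y : C} (x : X ⟶ T.obj t) (y : Y ⟶ T.obj t) :
    collComp T ht x Y ⟶ T.obj t :=
  collSnd T ht x Y ≫ T.map y ≫ T.μ.app t

variable {T ht}

theorem coll_ext {W X Y : C} {x : X ⟶ T.obj t} {f g : W ⟶ collComp T ht x Y}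
    (h1 : f ≫ collFst T ht x Y = g ≫ collFst T ht x Y)
    (h2 : f ≫ collSnd T ht x Y = g ≫ collSnd T ht x Y) : f = g :=
  (coll_isPullback T ht x Y).hom_ext h1 h2

variable (T ht)

/-- The map into `collComp T ht x Y` with given components. -/
noncomputable def collLift {W X Y : C} (x : X ⟶ T.obj t) (f : W ⟶ X) (g : W ⟶ T.obj Y)
    (h : f ≫ x = g ≫ T.map (ht.from Y)) : W ⟶ collComp T ht x Y :=
  (coll_isPullback T ht x Y).lift f g h

section
variable {W X Y V : C} (x : X ⟶ T.obj t) (f : W ⟶ X) (g : W ⟶ T.obj Y)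
    (h : f ≫ x = g ≫ T.map (ht.from Y))

theorem collLift_fst : collLift T ht x f g h ≫ collFst T ht x Y = f :=
  (coll_isPullback T ht x Y).lift_fst _ _ _

theorem collLift_fst_assoc (k : X ⟶ V) :
    collLift T ht x f g h ≫ collFst T ht x Y ≫ k = f ≫ k := by
  rw [← Category.assoc, collLift_fst]

theorem collLift_snd : collLift T ht x f g h ≫ collSnd T ht x Y = g :=
  (coll_isPullback T ht x Y).lift_snd _ _ _

theorem collLift_snd_assoc (k : T.obj Y ⟶ V) :
    collLift T ht x f g h ≫ collSnd T ht x Y ≫ k = g ≫ k := by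
  rw [← Category.assoc, collLift_snd]

end

/-- Functoriality of the composition product. -/
noncomputable def collCompMap {X X' Y Y' : C} {x : X ⟶ T.obj t} {x' : X' ⟶ T.obj t} (f : X ⟶ X')
    (hf : f ≫ x' = x) (g : Y ⟶ Y') : collComp T ht x Y ⟶ collComp T ht x' Y' :=
  collLift T ht x' (collFst T ht x Y ≫ f) (collSnd T ht x Y ≫ T.map g) (by
    rw [Category.assoc, hf, Category.assoc, ← T.map_comp, ht.hom_ext (g ≫ _) (ht.from _),
      (coll_isPullback T ht x Y).w])

/-- The canonical map `X ∘ (Y ∘ Z) ⟶ (X ∘ Y) ∘ Z`, on elements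
`(x; (yᵢ; zᵢⱼ)) ↦ ((x; yᵢ); zᵢⱼ)`. If `T` is cartesian, it is invertible and its inverse is the
associativity isomorphism of the composition product. -/
noncomputable def collAssocInv {X Y : C} (x : X ⟶ T.obj t) (y : Y ⟶ T.obj t) (Z : C) :
    collComp T ht x (collComp T ht y Z) ⟶ collComp T ht (collCompHom T ht x y) Z :=
  collLift T ht _
    (collLift T ht x (collFst T ht x _) (collSnd T ht x _ ≫ T.map (collFst T ht y Z)) (by
      rw [Category.assoc, ← T.map_comp, ht.hom_ext (_ ≫ ht.from _) (ht.from _)]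
      exact (coll_isPullback T ht x _).w))
    (collSnd T ht x _ ≫ T.map (collSnd T ht y Z) ≫ T.μ.app Z) (by
      rw [collCompHom, collLift_snd_assoc]
      simp only [Category.assoc]
      rw [← T.map_comp_assoc, (coll_isPullback T ht y Z).w, T.map_comp, Category.assoc,
        T.mu_naturality])

/-- The unit `T`-collection `η : 1 ⟶ T1`. -/
def collUnit (t : C) : t ⟶ T.obj t := T.η.app t

theorem collUnit_natural (X : C) :
    ht.from X ≫ collUnit T t = T.η.app X ≫ T.map (ht.from X) :=
  T.η.naturality (ht.from X)

/-- The canonical map `X ⟶ 1 ∘ X`; if `T` is cartesian, it is the inverse of the left unit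
isomorphism. -/
noncomputable def collLeftInv (X : C) : X ⟶ collComp T ht (collUnit T t) X :=
  collLift T ht (W := X) (collUnit T t) (ht.from X) (T.η.app X) (collUnit_natural T ht X)

/-- The canonical map `X ⟶ X ∘ 1`, the inverse of the right unit isomorphism. -/
noncomputable def collRightInv {X : C} (x : X ⟶ T.obj t) : X ⟶ collComp T ht x t :=
  collLift T ht x (𝟙 X) x (by rw [ht.hom_ext (ht.from t) (𝟙 t)]; simp)

section
variable {X X' X'' Y Y' Y'' Z Z' V : C} {x : X ⟶ T.obj t} {x' : X' ⟶ T.obj t} {x'' : X'' ⟶ T.obj t}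
  {y : Y ⟶ T.obj t} {y' : Y' ⟶ T.obj t} (z : Z ⟶ T.obj t)

theorem collCompMap_fst (f : X ⟶ X') (hf : f ≫ x' = x) (g : Y ⟶ Y') :
    collCompMap T ht f hf g ≫ collFst T ht x' Y' = collFst T ht x Y ≫ f :=
  collLift_fst ..

theorem collCompMap_fst_assoc (f : X ⟶ X') (hf : f ≫ x' = x) (g : Y ⟶ Y') (k : X' ⟶ V) :
    collCompMap T ht f hf g ≫ collFst T ht x' Y' ≫ k = collFst T ht x Y ≫ f ≫ k := by
  rw [← Category.assoc, collCompMap_fst, Category.assoc]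

theorem collCompMap_snd (f : X ⟶ X') (hf : f ≫ x' = x) (g : Y ⟶ Y') :
    collCompMap T ht f hf g ≫ collSnd T ht x' Y' = collSnd T ht x Y ≫ T.map g :=
  collLift_snd ..

theorem collCompMap_snd_assoc (f : X ⟶ X') (hf : f ≫ x' = x) (g : Y ⟶ Y') (k : T.obj Y' ⟶ V) :
    collCompMap T ht f hf g ≫ collSnd T ht x' Y' ≫ k = collSnd T ht x Y ≫ T.map g ≫ k := by
  rw [← Category.assoc, collCompMap_snd, Category.assoc]

theorem collAssocInv_fst_fst (x : X ⟶ T.obj t) (y : Y ⟶ T.obj t) (Z : C) :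
    collAssocInv T ht x y Z ≫ collFst T ht _ Z ≫ collFst T ht x Y = collFst T ht x _ := by
  rw [collAssocInv, collLift_fst_assoc, collLift_fst]

theorem collAssocInv_fst_fst_assoc (x : X ⟶ T.obj t) (y : Y ⟶ T.obj t) (Z : C) (k : X ⟶ V) :
    collAssocInv T ht x y Z ≫ collFst T ht _ Z ≫ collFst T ht x Y ≫ k =
      collFst T ht x _ ≫ k := by
  rw [collAssocInv, collLift_fst_assoc, collLift_fst_assoc]

theorem collAssocInv_fst_snd (x : X ⟶ T.obj t) (y : Y ⟶ T.obj t) (Z : C) :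
    collAssocInv T ht x y Z ≫ collFst T ht _ Z ≫ collSnd T ht x Y =
      collSnd T ht x _ ≫ T.map (collFst T ht y Z) := by
  rw [collAssocInv, collLift_fst_assoc, collLift_snd]

theorem collAssocInv_fst_snd_assoc (x : X ⟶ T.obj t) (y : Y ⟶ T.obj t) (Z : C)
    (k : T.obj Y ⟶ V) :
    collAssocInv T ht x y Z ≫ collFst T ht _ Z ≫ collSnd T ht x Y ≫ k =
      collSnd T ht x _ ≫ T.map (collFst T ht y Z) ≫ k := by
  rw [collAssocInv, collLift_fst_assoc, collLift_snd_assoc, Category.assoc]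

theorem collAssocInv_snd (x : X ⟶ T.obj t) (y : Y ⟶ T.obj t) (Z : C) :
    collAssocInv T ht x y Z ≫ collSnd T ht _ Z =
      collSnd T ht x _ ≫ T.map (collSnd T ht y Z) ≫ T.μ.app Z := by
  rw [collAssocInv, collLift_snd]

theorem collAssocInv_snd_assoc (x : X ⟶ T.obj t) (y : Y ⟶ T.obj t) (Z : C) (k : T.obj Z ⟶ V) :
    collAssocInv T ht x y Z ≫ collSnd T ht _ Z ≫ k =
      collSnd T ht x _ ≫ T.map (collSnd T ht y Z) ≫ T.μ.app Z ≫ k := by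
  rw [collAssocInv, collLift_snd_assoc, Category.assoc, Category.assoc]

theorem collCompMap_comp (f : X ⟶ X') (hf : f ≫ x' = x) (g : Y ⟶ Y') (f' : X' ⟶ X'')
    (hf' : f' ≫ x'' = x') (g' : Y' ⟶ Y'') (h : (f ≫ f') ≫ x'' = x) :
    collCompMap T ht f hf g ≫ collCompMap T ht f' hf' g' =
      collCompMap T ht (f ≫ f') h (g ≫ g') := by
  apply coll_ext <;>
  simp only [Category.assoc, collCompMap_fst, collCompMap_fst_assoc, collCompMap_snd,
    collCompMap_snd_assoc, T.map_comp]

theorem collCompMap_id (Y : C) (h : 𝟙 X ≫ x = x) : collCompMap T ht (𝟙 X) h (𝟙 Y) = 𝟙 _ := by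
  apply coll_ext <;> simp only [collCompMap_fst, collCompMap_snd, Category.comp_id,
    Category.id_comp, T.map_id]

theorem collCompMap_over (f : X ⟶ X') (hf : f ≫ x' = x) (g : Y ⟶ Y') (hg : g ≫ y' = y) :
    collCompMap T ht f hf g ≫ collCompHom T ht x' y' = collCompHom T ht x y := by
  rw [collCompHom, collCompMap_snd_assoc, ← T.map_comp_assoc, hg, collCompHom]

theorem collAssocInv_over (x : X ⟶ T.obj t) (y : Y ⟶ T.obj t) :
    collAssocInv T ht x y Z ≫ collCompHom T ht (collCompHom T ht x y) z =
      collCompHom T ht x (collCompHom T ht y z) := by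
  change _ ≫ collSnd T ht _ Z ≫ T.map z ≫ _ =
    collSnd T ht x _ ≫ T.map (collSnd T ht y Z ≫ T.map z ≫ T.μ.app t) ≫ _
  rw [collAssocInv_snd_assoc, T.map_comp, T.map_comp,
    Category.assoc, Category.assoc, T.assoc, ← T.mu_naturality_assoc]

/-- Naturality of the comparison map. -/
theorem collAssocInv_natural (f : X ⟶ X') (hf : f ≫ x' = x) (g : Y ⟶ Y') (hg : g ≫ y' = y)
    (h : Z ⟶ Z') :
    collCompMap T ht f hf (collCompMap T ht g hg h) ≫ collAssocInv T ht x' y' Z' =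
      collAssocInv T ht x y Z ≫
        collCompMap T ht (collCompMap T ht f hf g) (collCompMap_over T ht f hf g hg) h := by
  apply coll_ext
  · apply coll_ext
    · simp only [Category.assoc, collAssocInv_fst_fst, collCompMap_fst, collCompMap_fst_assoc,
        collAssocInv_fst_fst_assoc]
    · simp only [Category.assoc, collAssocInv_fst_snd, collCompMap_fst, collCompMap_fst_assoc,
        collAssocInv_fst_snd_assoc, collCompMap_snd, collCompMap_snd_assoc, ← T.map_comp]
  · simp only [Category.assoc, collAssocInv_snd, collCompMap_snd, collCompMap_snd_assoc,
        collAssocInv_snd_assoc, ← T.map_comp_assoc]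
    simp only [T.map_comp, Category.assoc, T.mu_naturality]

/-- The pentagon for the comparison map. -/
theorem collAssocInv_pentagon (x : X ⟶ T.obj t) (y : Y ⟶ T.obj t) (W : C) :
    collAssocInv T ht x y (collComp T ht z W) ≫ collAssocInv T ht (collCompHom T ht x y) z W =
      collCompMap T ht (𝟙 X) (Category.id_comp x) (collAssocInv T ht y z W) ≫
        collAssocInv T ht x (collCompHom T ht y z) W ≫
        collCompMap T ht (collAssocInv T ht x y Z) (collAssocInv_over T ht z x y) (𝟙 W) := by
  apply coll_ext
  · apply coll_ext
    · apply coll_ext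
      · simp only [Category.assoc, collAssocInv_fst_fst, collCompMap_fst, collCompMap_fst_assoc,
          collAssocInv_fst_fst_assoc, Category.comp_id]
      · simp only [Category.assoc, collAssocInv_fst_fst, collCompMap_fst, collCompMap_fst_assoc,
          collAssocInv_fst_fst_assoc, Category.comp_id, collAssocInv_fst_snd, collCompMap_snd_assoc,
          collAssocInv_fst_snd_assoc, ← T.map_comp]
    · simp only [Category.assoc, collAssocInv_fst_snd, collCompMap_fst, collCompMap_fst_assoc,
        collAssocInv_fst_snd_assoc, collAssocInv_snd, collAssocInv_snd_assoc, collCompMap_snd_assoc,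
        ← T.map_comp_assoc]
      simp only [T.map_comp, Category.assoc, T.mu_naturality]
  · simp only [Category.assoc, collAssocInv_snd, collCompMap_snd, collCompMap_snd_assoc,
        collAssocInv_snd_assoc, ← T.map_comp_assoc]
    simp only [T.map_comp, Category.assoc, T.mu_naturality_assoc, T.assoc, T.map_id,
      Category.comp_id]

theorem collLeftInv_natural (f : X ⟶ Y) :
    f ≫ collLeftInv T ht Y =
      collLeftInv T ht X ≫ collCompMap T ht (𝟙 t) (Category.id_comp _) f := by
  apply coll_ext
  · exact ht.hom_ext _ _
  · simp only [Category.assoc, collCompMap_snd, collLeftInv, collLift_snd, collLift_snd_assoc,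
      T.unit_naturality]

theorem collLeftInv_over : collLeftInv T ht X ≫ collCompHom T ht (collUnit T t) x = x := by
  rw [collLeftInv, collCompHom, collLift_snd_assoc, ← T.unit_naturality_assoc]
  simp

theorem collLeftInv_comp (y : Y ⟶ T.obj t) (Z : C) :
    collLeftInv T ht (collComp T ht y Z) ≫ collAssocInv T ht (collUnit T t) y Z =
      collCompMap T ht (collLeftInv T ht Y) (collLeftInv_over T ht) (𝟙 Z) := by
  apply coll_ext
  · apply coll_ext
    · exact ht.hom_ext _ _
    · simp only [Category.assoc, collAssocInv_fst_snd, collCompMap_fst_assoc]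
      simp only [collLeftInv, collLift_snd, collLift_snd_assoc, T.unit_naturality]
  · simp only [Category.assoc, collAssocInv_snd, collCompMap_snd]
    simp only [collLeftInv, collLift_snd_assoc, ← T.unit_naturality_assoc, T.left_unit, T.map_id]
    rfl

theorem collRightInv_over : collRightInv T ht x ≫ collCompHom T ht x (collUnit T t) = x := by
  rw [collRightInv, collCompHom, collLift_snd_assoc, collUnit]
  simp

theorem collRightInv_comp (x : X ⟶ T.obj t) (Z : C) :
    collCompMap T ht (𝟙 X) (Category.id_comp x) (collLeftInv T ht Z) ≫
        collAssocInv T ht x (collUnit T t) Z =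
      collCompMap T ht (collRightInv T ht x) (collRightInv_over T ht) (𝟙 Z) := by
  apply coll_ext
  · apply coll_ext
    · simp only [Category.assoc, collAssocInv_fst_fst, collCompMap_fst, collCompMap_fst_assoc,
        collRightInv, collLift_fst]
    · simp only [Category.assoc, collAssocInv_fst_snd, collCompMap_fst_assoc,
        collCompMap_snd_assoc, collRightInv, collLift_snd, ← T.map_comp, collLeftInv,
        collLift_fst]
      exact (coll_isPullback T ht x Z).w.symm
  · simp only [Category.assoc, collAssocInv_snd, collCompMap_snd, collCompMap_snd_assoc,
      ← T.map_comp_assoc]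
    simp only [collLeftInv, collLift_snd, T.right_unit, T.map_id]
    rfl

end

section
variable {T} {X Y : C} (x : X ⟶ T.obj t) (y : Y ⟶ T.obj t)

theorem isIso_collAssocInv (hT : IsCartesianMonad T) (Z : C) :
    IsIso (collAssocInv T ht x y Z) := by
  have s1 : IsPullback (collSnd T ht x (collComp T ht y Z))
      (collAssocInv T ht x y Z ≫ collFst T ht _ Z) (T.map (collFst T ht y Z))
      (collSnd T ht x Y) := by
    refine IsPullback.of_bot ?_ ((collAssocInv_fst_snd T ht x y Z).symm.trans
      (Category.assoc _ _ _).symm)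
      (coll_isPullback T ht x Y).flip
    have e : T.map (collFst T ht y Z) ≫ T.map (ht.from Y) = T.map (ht.from _) := by
      rw [← T.map_comp]; congr 1; exact ht.hom_ext _ _
    rw [e, Category.assoc, collAssocInv_fst_fst]
    exact (coll_isPullback T ht x _).flip
  have s2 := (hT.map_isPullback (coll_isPullback T ht y Z)).flip
  have s3 := (hT.mult (ht.from Z)).flip
  have s := ((s1.paste_horiz s2).paste_horiz s3).flip
  have s' := coll_isPullback T ht (collCompHom T ht x y) Z
  have hc : collSnd T ht x Y ≫ T.map y ≫ T.μ.app t = collCompHom T ht x y := rfl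
  rw [Category.assoc (collSnd T ht x Y), hc] at s
  have he : collAssocInv T ht x y Z = (IsPullback.isoIsPullback _ _ s s').hom := by
    apply coll_ext
    · rw [IsPullback.isoIsPullback_hom_fst]
    · rw [IsPullback.isoIsPullback_hom_snd, collAssocInv_snd, Category.assoc]
  rw [he]
  infer_instance

theorem isIso_collLeftInv (hT : IsCartesianMonad T) (X : C) : IsIso (collLeftInv T ht X) := by
  have s : IsPullback (ht.from X) (T.η.app X) (collUnit T t) (T.map (ht.from X)) :=
    hT.unit (ht.from X)
  have he : collLeftInv T ht X =
      (IsPullback.isoIsPullback _ _ s (coll_isPullback T ht (collUnit T t) X)).hom := by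
    apply coll_ext
    · exact ht.hom_ext _ _
    · rw [IsPullback.isoIsPullback_hom_snd, collLeftInv, collLift_snd]
  rw [he]
  infer_instance

theorem isIso_collRightInv : IsIso (collRightInv T ht x) := by
  refine ⟨collFst T ht x t, collLift_fst .., ?_⟩
  apply coll_ext
  · rw [Category.assoc, collRightInv, collLift_fst, Category.comp_id, Category.id_comp]
  · rw [Category.assoc, collRightInv, collLift_snd, (coll_isPullback T ht x t).w,
      ht.hom_ext (ht.from t) (𝟙 t), T.map_id, Category.comp_id, Category.id_comp]

end

/-- The structure of a `T`-operad on a `T`-collection `k : K ⟶ T1`: a monoid structure for the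
composition product, that is, a multiplication `K ∘ K ⟶ K` and a unit `1 ⟶ K` over `T1` which are
associative and unital. -/
structure TOperad {K : C} (k : K ⟶ T.obj t) where
  mul : collComp T ht k K ⟶ K
  mul_over : mul ≫ k = collCompHom T ht k k
  unit : t ⟶ K
  unit_over : unit ≫ k = collUnit T t
  assoc : collCompMap T ht (𝟙 K) (Category.id_comp k) mul ≫ mul =
    collAssocInv T ht k k K ≫ collCompMap T ht mul mul_over (𝟙 K) ≫ mul
  unit_mul : collLeftInv T ht K ≫ collCompMap T ht unit unit_over (𝟙 K) ≫ mul = 𝟙 K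
  mul_unit : collRightInv T ht k ≫ collCompMap T ht (𝟙 K) (Category.id_comp k) unit ≫ mul = 𝟙 K

namespace TOperad

variable {T ht} {K : C} {k : K ⟶ T.obj t}

theorem comp_id_over (S : TOperad T ht k) :
    collCompMap T ht S.mul S.mul_over (𝟙 K) ≫ collCompHom T ht k k =
      collCompHom T ht (collCompHom T ht k k) k :=
  collCompMap_over T ht _ _ _ (Category.id_comp k)

/-- The monad on `C` induced by a `T`-operad `K`: it sends `X` to the pullback of `k : K ⟶ T1`
along `T! : TX ⟶ T1`. -/
noncomputable def inducedMonad (S : TOperad T ht k) : Monad C where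
  obj X := collComp T ht k X
  map f := collCompMap T ht (𝟙 K) (Category.id_comp k) f
  map_id X := collCompMap_id T ht X _
  map_comp f g := by
    rw [collCompMap_comp T ht _ _ _ _ _ _ (by simp)]
    congr 1
    exact (Category.id_comp _).symm
  η :=
    { app X := collLeftInv T ht X ≫ collCompMap T ht S.unit S.unit_over (𝟙 X)
      naturality X Y f := by
        have h := collLeftInv_natural T ht f
        change f ≫ _ ≫ _ = (_ ≫ _) ≫ collCompMap T ht (𝟙 K) (Category.id_comp k) f
        rw [← Category.assoc, h, Category.assoc, Category.assoc,
          collCompMap_comp T ht _ _ _ _ _ _ (by simp [S.unit_over]),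
          collCompMap_comp T ht _ _ _ _ _ _ (by simp [S.unit_over])]
        congr 2 <;> simp }
  μ :=
    { app X := collAssocInv T ht k k X ≫ collCompMap T ht S.mul S.mul_over (𝟙 X)
      naturality X Y f := by
        have h := collAssocInv_natural T ht (𝟙 K) (Category.id_comp k) (𝟙 K) (Category.id_comp k) f
        change collCompMap T ht (𝟙 K) (Category.id_comp k)
          (collCompMap T ht (𝟙 K) (Category.id_comp k) f) ≫ _ ≫ _ =
          (_ ≫ _) ≫ collCompMap T ht (𝟙 K) (Category.id_comp k) f
        rw [← Category.assoc, h, Category.assoc, Category.assoc,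
          collCompMap_comp T ht _ _ _ _ _ _ (by simp [S.mul_over, collCompMap_id]),
          collCompMap_comp T ht _ _ _ _ _ _ (by simp [S.mul_over])]
        congr 2
        · simp [collCompMap_id]
        · simp }
  assoc X := by
    change collCompMap T ht (𝟙 K) (Category.id_comp k)
        (collAssocInv T ht k k X ≫ collCompMap T ht S.mul S.mul_over (𝟙 X)) ≫
        collAssocInv T ht k k X ≫ collCompMap T ht S.mul S.mul_over (𝟙 X) =
      (collAssocInv T ht k k (collComp T ht k X) ≫
        collCompMap T ht S.mul S.mul_over (𝟙 (collComp T ht k X))) ≫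
        collAssocInv T ht k k X ≫ collCompMap T ht S.mul S.mul_over (𝟙 X)
    have e0 : collCompMap T ht (𝟙 K) (Category.id_comp k)
        (collAssocInv T ht k k X ≫ collCompMap T ht S.mul S.mul_over (𝟙 X)) =
        collCompMap T ht (𝟙 K) (Category.id_comp k) (collAssocInv T ht k k X) ≫
        collCompMap T ht (𝟙 K) (Category.id_comp k) (collCompMap T ht S.mul S.mul_over (𝟙 X)) := by
      rw [collCompMap_comp T ht _ _ _ _ _ _ (by simp)]
      congr 1
      simp
    have n1 := collAssocInv_natural T ht (𝟙 K) (Category.id_comp k) S.mul S.mul_over (𝟙 X)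
    have n2 := collAssocInv_natural T ht S.mul S.mul_over (𝟙 K) (Category.id_comp k) (𝟙 X)
    rw [collCompMap_id] at n2
    have p := collAssocInv_pentagon T ht k k k X
    have hov : (collCompMap T ht (𝟙 K) (Category.id_comp k) S.mul ≫ S.mul) ≫ k =
        collCompHom T ht k (collCompHom T ht k k) := by
      rw [Category.assoc, S.mul_over,
        collCompMap_over T ht (𝟙 K) (Category.id_comp k) S.mul S.mul_over]
    have hov2 : (collCompMap T ht S.mul S.mul_over (𝟙 K) ≫ S.mul) ≫ k =
        collCompHom T ht (collCompHom T ht k k) k := by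
      rw [Category.assoc, S.mul_over, S.comp_id_over]
    have hov3 : (collAssocInv T ht k k K ≫ collCompMap T ht S.mul S.mul_over (𝟙 K) ≫ S.mul) ≫ k =
        collCompHom T ht k (collCompHom T ht k k) := by
      rw [← S.assoc, hov]
    have e1 : collCompMap T ht (collCompMap T ht (𝟙 K) (Category.id_comp k) S.mul)
        (collCompMap_over T ht _ _ _ S.mul_over) (𝟙 X) ≫
          collCompMap T ht S.mul S.mul_over (𝟙 X) =
        collCompMap T ht (collAssocInv T ht k k K) (collAssocInv_over T ht k k k) (𝟙 X) ≫
          collCompMap T ht (collCompMap T ht S.mul S.mul_over (𝟙 K)) S.comp_id_over (𝟙 X) ≫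
          collCompMap T ht S.mul S.mul_over (𝟙 X) := by
      rw [collCompMap_comp T ht _ _ _ _ _ _ hov, collCompMap_comp T ht _ _ _ _ _ _ hov2,
        collCompMap_comp T ht _ _ _ _ _ _ hov3]
      congr 1
      · exact S.assoc
      · simp
    rw [e0, Category.assoc, reassoc_of% n1, e1]
    rw [Category.assoc, reassoc_of% n2, reassoc_of% p]
  left_unit X := by
    change (collLeftInv T ht (collComp T ht k X) ≫
        collCompMap T ht S.unit S.unit_over (𝟙 (collComp T ht k X))) ≫
        collAssocInv T ht k k X ≫ collCompMap T ht S.mul S.mul_over (𝟙 X) = 𝟙 _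
    have n2 := collAssocInv_natural T ht S.unit S.unit_over (𝟙 K) (Category.id_comp k) (𝟙 X)
    rw [collCompMap_id] at n2
    have hov : (collCompMap T ht S.unit S.unit_over (𝟙 K) ≫ S.mul) ≫ k =
        collCompHom T ht (collUnit T t) k := by
      rw [Category.assoc, S.mul_over, collCompMap_over T ht _ S.unit_over _ (Category.id_comp k)]
    rw [Category.assoc, reassoc_of% n2, ← Category.assoc, collLeftInv_comp, collCompMap_comp T ht _ _ _ _ _ _ hov,
      collCompMap_comp T ht _ _ _ _ _ _ (by rw [S.unit_mul, Category.id_comp])]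
    refine Eq.trans ?_ (collCompMap_id T ht X (Category.id_comp k))
    congr 1
    · exact S.unit_mul
    · simp
  right_unit X := by
    change collCompMap T ht (𝟙 K) (Category.id_comp k)
        (collLeftInv T ht X ≫ collCompMap T ht S.unit S.unit_over (𝟙 X)) ≫
        collAssocInv T ht k k X ≫ collCompMap T ht S.mul S.mul_over (𝟙 X) = 𝟙 _
    have e0 : collCompMap T ht (𝟙 K) (Category.id_comp k)
        (collLeftInv T ht X ≫ collCompMap T ht S.unit S.unit_over (𝟙 X)) =
        collCompMap T ht (𝟙 K) (Category.id_comp k) (collLeftInv T ht X) ≫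
        collCompMap T ht (𝟙 K) (Category.id_comp k)
          (collCompMap T ht S.unit S.unit_over (𝟙 X)) := by
      rw [collCompMap_comp T ht _ _ _ _ _ _ (by simp)]
      congr 1
      simp
    have n1 := collAssocInv_natural T ht (𝟙 K) (Category.id_comp k) S.unit S.unit_over (𝟙 X)
    have hov : (collCompMap T ht (𝟙 K) (Category.id_comp k) S.unit ≫ S.mul) ≫ k =
        collCompHom T ht k (collUnit T t) := by
      rw [Category.assoc, S.mul_over, collCompMap_over T ht _ (Category.id_comp k) _ S.unit_over]
    rw [e0, Category.assoc, reassoc_of% n1, ← Category.assoc, collRightInv_comp,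
      collCompMap_comp T ht _ _ _ _ _ _ hov,
      collCompMap_comp T ht _ _ _ _ _ _ (by rw [S.mul_unit, Category.id_comp])]
    refine Eq.trans ?_ (collCompMap_id T ht X (Category.id_comp k))
    congr 1
    · exact S.mul_unit
    · simp

/-- The projection of the induced monad onto `T`. -/
noncomputable def proj (S : TOperad T ht k) : S.inducedMonad.toFunctor ⟶ T.toFunctor where
  app X := collSnd T ht k X
  naturality _ _ f := collCompMap_snd T ht (𝟙 K) (Category.id_comp k) f

end TOperad
end GeneralizedOperads

/-! ### The groupoid `BΛ` and the comparison with the symmetric groups -/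

/-- The objects of `BΛ = ∐ₙ BΛ(n)`: one object for each natural number. -/
@[ext]
structure BCat (Λ : ActionOperad.{w}) : Type v where
  deg : ℕ

namespace BCat

variable {Λ : ActionOperad.{w}}

/-- The morphisms `m ⟶ n` of `BΛ` are the elements of `Λ(m)` if `m = n`, and there are none
otherwise. -/
structure Hom (m n : BCat.{w, v} Λ) : Type (max w v) where
  deg_eq : m.deg = n.deg
  elt : Λ.carrier m.deg

theorem Hom.ext' {m n : BCat.{w, v} Λ} {φ ψ : Hom m n} (h : φ.elt = ψ.elt) : φ = ψ := by
  obtain ⟨_, g⟩ := φ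
  obtain ⟨_, g'⟩ := ψ
  obtain rfl : g = g' := h
  rfl

/-- The composite of `g : n ⟶ n` followed by `g' : n ⟶ n` is `g' g`. -/
instance : Category (BCat.{w, v} Λ) where
  Hom m n := Hom m n
  id m := ⟨rfl, 1⟩
  comp φ ψ := ⟨φ.deg_eq.trans ψ.deg_eq, castIdx φ.deg_eq.symm ψ.elt * φ.elt⟩
  id_comp φ := Hom.ext' (mul_one _)
  comp_id {m n} φ := by
    obtain ⟨m⟩ := m
    obtain ⟨n⟩ := n
    obtain rfl : m = n := φ.deg_eq
    exact Hom.ext' (one_mul _)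
  assoc {m n p q} φ ψ χ := by
    obtain ⟨m⟩ := m
    obtain ⟨n⟩ := n
    obtain ⟨p⟩ := p
    obtain ⟨q⟩ := q
    obtain rfl : m = n := φ.deg_eq
    obtain rfl : m = p := ψ.deg_eq
    obtain rfl : m = q := χ.deg_eq
    exact Hom.ext' (mul_assoc _ _ _).symm

theorem comp_elt {m n p : BCat.{w, v} Λ} (φ : m ⟶ n) (ψ : n ⟶ p) :
    Hom.elt (φ ≫ ψ) = castIdx (Hom.deg_eq φ).symm (Hom.elt ψ) * Hom.elt φ := rfl

end BCat

theorem ActionOperad.castIdx_pi (Λ : ActionOperad.{w}) {m n : ℕ} (h : m = n) (g : Λ.carrier m) :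
    Λ.pi n (castIdx h g) = castIdx (A := symmOperad.carrier) h (Λ.pi m g) := by
  subst h; rfl

/-- The functor `Bπ : BΛ ⥤ BΣ`, the identity on objects and `π` on morphisms. -/
def bPi (Λ : ActionOperad.{w}) : BCat.{w, max w u} Λ ⥤ BCat.{0, max w u} symmOperad where
  obj n := ⟨n.deg⟩
  map {m n} φ := ⟨BCat.Hom.deg_eq (m := m) (n := n) φ,
    Λ.pi m.deg (BCat.Hom.elt (m := m) (n := n) φ)⟩
  map_id n := BCat.Hom.ext' (map_one (Λ.pi n.deg))
  map_comp φ _ := BCat.Hom.ext' ((map_mul (Λ.pi _) _ _).trans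
    (congrArg (· * Λ.pi _ (BCat.Hom.elt φ)) (Λ.castIdx_pi (BCat.Hom.deg_eq φ).symm _)))

/-- The terminal category `1`. -/
abbrev onePt : Cat.{u, u} := Cat.of (Discrete PUnit)

/-- The category `onePt` is terminal. -/
abbrev onePtTerminal : IsTerminal onePt.{u} := Cat.isTerminalDiscretePUnit

/-- The isomorphism `BΛ ≅ EΛ(1)`: the object `n` is sent to `[e; *, …, *]`, and `g ∈ Λ(n)` to the
morphism given by `g` and identities. -/
def bIso (Λ : ActionOperad.{w}) :
    Cat.of (BCat.{w, max w u} Λ) ≅ (borelMonad.{w, u} Λ).obj onePt.{max w u} where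
  hom := Functor.toCatHom
    { obj n := (⟨n.deg, fun _ => ⟨PUnit.unit⟩⟩ : BorelCat Λ (Discrete PUnit))
      map φ := ⟨BCat.Hom.deg_eq φ, BCat.Hom.elt φ, fun _ _ _ => 𝟙 _⟩
      map_id _ := BorelCat.Hom.ext' rfl fun _ _ _ _ => rfl
      map_comp _ _ := BorelCat.Hom.ext' rfl fun _ _ _ _ => rfl }
  inv := Functor.toCatHom (C := BorelCat Λ (Discrete PUnit))
    { obj p := ⟨p.len⟩
      map φ := ⟨BorelCat.Hom.len_eq φ, BorelCat.Hom.elt φ⟩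
      map_id _ := rfl
      map_comp _ _ := rfl }
  hom_inv_id := rfl
  inv_hom_id := rfl

/-- The monad `EΣ` on the category of small categories. -/
abbrev symmMonad : Monad Cat.{u, u} := borelMonad.{0, u} symmOperad

/-- The transformation `π̃ : EΛ ⟶ EΣ` induced by `π`. -/
def comparison (Λ : ActionOperad.{w}) :
    (borelMonad.{w, u} Λ).toFunctor ⟶ symmMonad.{max w u}.toFunctor where
  app X := Functor.toCatHom (C := BorelCat Λ X) (D := BorelCat symmOperad X)
    { obj p := ⟨p.len, p.pt⟩
      map {p q} φ := ⟨BorelCat.Hom.len_eq (p := p) (q := q) φ,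
        Λ.pi p.len (BorelCat.Hom.elt (p := p) (q := q) φ),
        fun i j h => BorelCat.Hom.map (p := p) (q := q) φ i j h⟩
      map_id p := BorelCat.Hom.ext' (map_one (Λ.pi p.len)) fun _ _ _ _ => rfl
      map_comp φ _ := BorelCat.Hom.ext' ((map_mul (Λ.pi _) _ _).trans
        (congrArg (· * Λ.pi _ (BorelCat.Hom.elt φ))
          (Λ.castIdx_pi (BorelCat.Hom.len_eq φ).symm _))) fun _ _ _ _ => rfl }
  naturality _ _ _ := rfl

/-! ### The Borel construction as a quotient -/

/-- The category `EΛ(n) × Xⁿ`, where `EΛ(n)` is the category with set of objects `Λ(n)` and a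
unique morphism between any two objects. -/
abbrev EPow (Λ : ActionOperad.{w}) (n : ℕ) (X : Type u) : Type max w u :=
  Codiscrete (Λ.carrier n) × (Fin n → X)

namespace EPow

section
variable (Λ : ActionOperad.{w}) (X : Type u) [Category.{v} X]

/-- The right action of `h ∈ Λ(n)` on `EΛ(n)`: `(g; x₁, …, xₙ) ↦ (gh; x₁, …, xₙ)`. -/
def rightAct {n : ℕ} (h : Λ.carrier n) : EPow Λ n X ⥤ EPow Λ n X :=
  (Codiscrete.functorOfFun fun g => g * h).prod (𝟭 _)

/-- The left action of `h ∈ Λ(n)` on `Xⁿ`: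
`(g; x₁, …, xₙ) ↦ (g; x_{π(h)⁻¹(1)}, …, x_{π(h)⁻¹(n)})`. -/
def leftAct {n : ℕ} (h : Λ.carrier n) : EPow Λ n X ⥤ EPow Λ n X :=
  (𝟭 _).prod (Pi.comap (fun _ => X) ((Λ.pi n h)⁻¹ : Equiv.Perm (Fin n)))

/-- The functor sending `(g; x₁, …, xₙ)` to its class
`[g; x₁, …, xₙ] = [e; x_{π(g)⁻¹(1)}, …, x_{π(g)⁻¹(n)}]`. The class of a morphism
`(!; f₁, …, fₙ) : (g; x₁, …, xₙ) ⟶ (g'; x'₁, …, x'ₙ)` has underlying group element `g'g⁻¹`. -/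
def quot (n : ℕ) : EPow Λ n X ⥤ BorelCat Λ X where
  obj p := ⟨n, fun i => p.2 ((Λ.pi n p.1.as)⁻¹ i)⟩
  map {p q} f := ⟨rfl, q.1.as * p.1.as⁻¹, fun i j h =>
    f.2 ((Λ.pi n p.1.as)⁻¹ i) ≫ eqToHom (by
      obtain rfl : j = Λ.pi n (q.1.as * p.1.as⁻¹) i := Fin.ext h
      simp)⟩
  map_id p := by
    refine BorelCat.Hom.ext' (mul_inv_cancel _) fun i j h1 h2 => ?_
    obtain rfl : j = i := Fin.ext (by rw [BorelCat.id_elt] at h2; simpa using h2)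
    simp [BorelCat.id_map]
  map_comp {p q r} f g := by
    refine BorelCat.Hom.ext' ?_ fun i j h1 h2 => ?_
    · rw [BorelCat.comp_elt]
      simp [castIdx]
    · have key : ∀ (a b : Fin n) (y : X) (e : b = a) (e2 : r.2 b = y),
          g.2 a ≫ eqToHom ((congrArg r.2 e.symm).trans e2) =
            eqToHom (congrArg q.2 e.symm) ≫ g.2 b ≫ eqToHom e2 := by
        rintro a _ y rfl _; simp
      change (f.2 _ ≫ g.2 _) ≫ _ = (f.2 _ ≫ _) ≫ (g.2 _ ≫ _)
      rw [Category.assoc, Category.assoc]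
      congr 1
      exact key _ _ _ (by simp) _

/-- `x ↦ (u; x)`, where `u` is the operad unit. -/
def unit : X ⥤ EPow Λ 1 X :=
  Functor.prod' (Codiscrete.functor fun _ => Λ.unit) (Functor.pi' fun _ => 𝟭 X)

/-- The functor
`EΛ(n) × ∏ᵢ (EΛ(kᵢ) × X^{kᵢ}) ⥤ EΛ(k₁ + ⋯ + kₙ) × X^{k₁ + ⋯ + kₙ}`
given by the operad multiplication and the concatenation of tuples. -/
def concat {n : ℕ} (k : Fin n → ℕ) :
    Codiscrete (Λ.carrier n) × (∀ i, EPow Λ (k i) X) ⥤ EPow Λ (∑ i, k i) X where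
  obj p := ⟨⟨Λ.mul p.1.as fun i => (p.2 i).1.as⟩,
    fun a => (p.2 (finSigmaFinEquiv.symm a).1).2 (finSigmaFinEquiv.symm a).2⟩
  map f := ⟨(), fun a => (f.2 (finSigmaFinEquiv.symm a).1).2 (finSigmaFinEquiv.symm a).2⟩

end

end EPow

/-- The assertion that the monad `borelMonad Λ` is the Borel construction
`X ↦ ∐ₙ EΛ(n) ×_{Λ(n)} Xⁿ`, where `EΛ(n) ×_{Λ(n)} Xⁿ` is the coequalizer of the two actions of
`Λ(n)` on `EΛ(n) × Xⁿ`, with the functoriality, the unit and the multiplication induced by the operad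
structure of `Λ`. -/
structure IsBorelConstruction (Λ : ActionOperad.{w}) : Prop where
  coequalize : ∀ (X : Cat.{max w u, max w u}) (n : ℕ) (h : Λ.carrier n),
    EPow.rightAct Λ X h ⋙ EPow.quot Λ X n = EPow.leftAct Λ X h ⋙ EPow.quot Λ X n
  universal : ∀ (X D : Cat.{max w u, max w u}) (F : ∀ n, EPow Λ n X ⥤ D),
    (∀ (n : ℕ) (h : Λ.carrier n), EPow.rightAct Λ X h ⋙ F n = EPow.leftAct Λ X h ⋙ F n) →
    ∃! G : (borelMonad.{w, u} Λ).obj X ⥤ D, ∀ n, EPow.quot Λ X n ⋙ G = F n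
  map : ∀ {X Y : Cat.{max w u, max w u}} (F : X ⟶ Y) (n : ℕ),
    (𝟭 _).prod (Functor.pi fun _ => F.toFunctor) ⋙ EPow.quot Λ Y n =
      EPow.quot Λ X n ⋙ ((borelMonad.{w, u} Λ).map F).toFunctor
  unit : ∀ X : Cat.{max w u, max w u},
    EPow.unit Λ X ⋙ EPow.quot Λ X 1 = ((borelMonad.{w, u} Λ).η.app X).toFunctor
  mult : ∀ (X : Cat.{max w u, max w u}) (n : ℕ) (k : Fin n → ℕ),
    (𝟭 (Codiscrete (Λ.carrier n))).prod (Functor.pi fun i => EPow.quot Λ X (k i)) ⋙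
        EPow.quot Λ (BorelCat Λ X) n ⋙ ((borelMonad.{w, u} Λ).μ.app X).toFunctor =
      EPow.concat Λ X k ⋙ EPow.quot Λ X (∑ i, k i)

/-- A club: a `T`-operad in `Cat` for `T = EΣ`. The `T`-collections are the functors to
`EΣ(1) ≅ BΣ`. -/
abbrev Club {K : Cat.{u, u}} (k : K ⟶ Cat.of (BCat.{0, u} symmOperad)) : Type u :=
  TOperad symmMonad.{u} onePtTerminal.{u} (k ≫ (bIso.{0, u} symmOperad).hom)

/-! ### The operad of a cartesian morphism of monads -/

/-! `Λ(n)` acts freely on `EΛ(n)`, so every class in `EΛ(X)` has exactly one representative with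
group coordinate `e`. Objects are thus tuples of objects of `X`, and a morphism is an element `g ∈
Λ(n)` together with morphisms `fᵢ` of `X`. The operadic data `n`, `g` and the data from `X` are
independent except for matching lengths and endpoints, and a functor `X ⥤ Y` changes only the
latter. This is why every naturality square in question is a pullback: the operadic data are read
off over `Y`, the remaining data over `X`. For `π̃` the operadic datum is a lift of a permutation to
`Λ(n)` (`comparison_equifibered`); for the multiplication it is the block lengths and the outer and
inner group elements (`mult_equifibered`); for the unit it is trivial. `Cat.isPullback_of_bijective`
reduces each claim to bijectivity on objects and on morphisms.

The club is then formal. Let `α : S ⟶ T` be cartesian and compatible with units and multiplications,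
and let `K ≅ S1`. The naturality square of `α` at `X ⟶ 1` identifies `K ×_{T1} TX` with `SX`
(`collIso`). Hence `K ∘ K ≅ SK`, and the free algebra structure `S²1 ⟶ S1` becomes the
multiplication of `K`. Maps into `SX` are determined by their composites to `S1` and `TX`; checking
these shows that `collIso` carries the unit and multiplication of `S` to those built from `K`
(`collIso_unit`, `collIso_mult`). The same two identities, taken at `X = K`, supply the left unit
law and associativity of the operad.

It remains to see that the model by normal forms is the Borel construction. Each `(g; x)` is the
right translate by `g` of `(e; x)`, so an invariant family of functors is determined by its values
on the representatives, and these values assemble to a functor (`EPow.descend`). Agreement of the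
multiplications comes down to the inverse of a block permutation and to the action operad axiom
(`quotQuot_elt`). -/

section CartesianMorphism

variable {C : Type u} [Category.{v} C] [HasPullbacks C] {S T : Monad C} {t : C}
  (ht : IsTerminal t) {α : S.toFunctor ⟶ T.toFunctor} (hα : α.Equifibered)
  {K : C} (b : K ≅ S.obj t) {k : K ⟶ T.obj t} (hk : b.hom ≫ α.app t = k)

-- This is the naturality square of `α` at `X ⟶ 1`, with the corner `S1` replaced by `K` along `b`.
include hα hk in
theorem collIso_isPullback (X : C) :
    IsPullback (S.map (ht.from X) ≫ b.inv) (α.app X) k (T.map (ht.from X)) := by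
  refine (hα (ht.from X)).of_iso (Iso.refl _) b.symm (Iso.refl _) (Iso.refl _) ?_ ?_ ?_ ?_
  · simp
  · simp
  · simp [← hk]
  · simp

/-- The isomorphism `K ×_{T1} TX ≅ SX` for a cartesian `α : S ⟶ T` and `K ≅ S1`. -/
noncomputable def collIso (X : C) : collComp T ht k X ≅ S.obj X :=
  (coll_isPullback T ht k X).isoIsPullback _ _ (collIso_isPullback ht hα b hk X)

theorem collIso_map (X : C) :
    (collIso ht hα b hk X).hom ≫ S.map (ht.from X) = collFst T ht k X ≫ b.hom := by
  have h := (coll_isPullback T ht k X).isoIsPullback_hom_fst _ _ (collIso_isPullback ht hα b hk X)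
  rw [← h, Category.assoc, Category.assoc, b.inv_hom_id, Category.comp_id]
  rfl

theorem collIso_app (X : C) : (collIso ht hα b hk X).hom ≫ α.app X = collSnd T ht k X :=
  (coll_isPullback T ht k X).isoIsPullback_hom_snd _ _ (collIso_isPullback ht hα b hk X)

-- The two composites are the projections of a naturality square of `α`, which is a pullback. All
-- later equations between maps into `SX` are checked on these components.
include hα in
theorem equifibered_hom_ext {W X : C} {f g : W ⟶ S.obj X}
    (h1 : f ≫ S.map (ht.from X) = g ≫ S.map (ht.from X)) (h2 : f ≫ α.app X = g ≫ α.app X) :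
    f = g :=
  (hα (ht.from X)).hom_ext h1 h2

theorem collIso_natural {X Y : C} (f : X ⟶ Y) :
    collCompMap T ht (𝟙 K) (Category.id_comp k) f ≫ (collIso ht hα b hk Y).hom =
      (collIso ht hα b hk X).hom ≫ S.map f := by
  apply equifibered_hom_ext ht hα
  · rw [Category.assoc, Category.assoc, collIso_map, collCompMap_fst_assoc, ← S.map_comp,
      ht.hom_ext (f ≫ _) (ht.from _), collIso_map, Category.id_comp]
  · rw [Category.assoc, Category.assoc, collIso_app, α.naturality, collCompMap_snd,
      ← Category.assoc, collIso_app]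

/-- On elements both sides are `(x; (yᵢ; zᵢⱼ)) ↦ (x; yᵢ)`. -/
theorem collAssocInv_fst {X Y : C} (x : X ⟶ T.obj t) (y : Y ⟶ T.obj t) (Z : C) :
    collAssocInv T ht x y Z ≫ collFst T ht _ Z =
      collCompMap T ht (𝟙 X) (Category.id_comp x) (collFst T ht y Z) := by
  apply coll_ext
  · rw [Category.assoc, collAssocInv_fst_fst, collCompMap_fst, Category.comp_id]
  · rw [Category.assoc, collAssocInv_fst_snd, collCompMap_snd]

/-- The action of `S` on `K ≅ S1`, transported from the free algebra. -/
def freeAct : S.obj K ⟶ K := S.map b.hom ≫ S.μ.app t ≫ b.inv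

/-- With `freeAct b`, the object `K` is the free `S`-algebra on `1` carried along `b`; the two
algebra laws are those of `μ` at `1` after `b.inv` and `b.hom` cancel. -/
theorem freeAct_assoc : S.map (freeAct b) ≫ freeAct b = S.μ.app K ≫ freeAct b := by
  simp only [freeAct, S.map_comp, Category.assoc]
  have e := S.assoc t
  rw [← S.map_comp_assoc b.inv, b.inv_hom_id, S.map_id, Category.id_comp, reassoc_of% e,
    S.mu_naturality_assoc]

theorem unit_freeAct : S.η.app K ≫ freeAct b = 𝟙 K := by
  have e : S.η.app K ≫ S.map b.hom = b.hom ≫ S.η.app (S.obj t) := (S.η.naturality b.hom).symm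
  rw [freeAct, reassoc_of% e, S.left_unit_assoc, b.hom_inv_id]

/-- The multiplication `K ∘ K ≅ SK ⟶ K`. -/
noncomputable def collMul : collComp T ht k K ⟶ K :=
  (collIso ht hα b hk K).hom ≫ freeAct b

/-- The unit `1 ⟶ S1 ≅ K`. -/
def collOne : t ⟶ K := S.η.app t ≫ b.inv

variable (hη : ∀ X, S.η.app X ≫ α.app X = T.η.app X)
  (hμ : ∀ X, S.μ.app X ≫ α.app X = S.map (α.app X) ≫ α.app (T.obj X) ≫ T.μ.app X)

-- Compatibility of `α` with the multiplications turns `S²1 ⟶ S1 ⟶ T1` into a path through `T²1`;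
-- naturality of `α` at `k` then moves `k` under `T`.
include hμ in
theorem collMul_over : collMul ht hα b hk ≫ k = collCompHom T ht k k := by
  have e : S.map b.hom ≫ S.map (α.app t) = S.map k := by rw [← S.map_comp, hk]
  have n := α.naturality k
  refine Eq.trans (congrArg (collMul ht hα b hk ≫ ·) hk.symm) ?_
  rw [collMul, freeAct, collCompHom, ← collIso_app ht hα b hk]
  simp only [Category.assoc, Iso.inv_hom_id_assoc]
  rw [hμ, reassoc_of% e, reassoc_of% n]

include hη hk in
theorem collOne_over : collOne b ≫ k = collUnit T t := by
  rw [collOne, ← hk, Category.assoc, b.inv_hom_id_assoc, hη, collUnit]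

/-- Up to bracketing, the composite of the first two maps is the unit of the induced monad. The
identity serves twice: for all `X` in the isomorphism of monads, and at `X = K` in the left unit
law. -/
theorem collIso_unit (X : C) :
    collLeftInv T ht X ≫ collCompMap T ht (collOne b) (collOne_over b hk hη) (𝟙 X) ≫
      (collIso ht hα b hk X).hom = S.η.app X := by
  apply equifibered_hom_ext ht hα
  · rw [Category.assoc, Category.assoc, collIso_map, collCompMap_fst_assoc, collOne,
      Category.assoc, b.inv_hom_id, Category.comp_id, ← S.unit_naturality, collLeftInv,
      collLift_fst_assoc]
  · rw [Category.assoc, Category.assoc, collIso_app, collCompMap_snd, collLeftInv,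
      collLift_snd_assoc, T.map_id, Category.comp_id, hη]

/-- Over `S1`, both sides become `S(collFst ≫ b)` followed by `μ`, by naturality of `collIso` and of
`μ`. Over `TX`, the claim is the compatibility of `α` with the multiplications. It serves both the
isomorphism of monads and, at `X = K`, associativity of the operad. -/
theorem collIso_mult (X : C) :
    collAssocInv T ht k k X ≫
        collCompMap T ht (collMul ht hα b hk) (collMul_over ht hα b hk hμ) (𝟙 X) ≫
        (collIso ht hα b hk X).hom =
      (collIso ht hα b hk (collComp T ht k X)).hom ≫ S.map (collIso ht hα b hk X).hom ≫
        S.μ.app X := by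
  apply equifibered_hom_ext ht hα
  · have e := congrArg (· ≫ collMul ht hα b hk ≫ b.hom) (collAssocInv_fst ht k k X)
    simp only [Category.assoc] at e
    simp only [Category.assoc]
    rw [collIso_map, collCompMap_fst_assoc, e, collMul, freeAct]
    simp only [Category.assoc, Iso.inv_hom_id, Category.comp_id]
    rw [← Category.assoc, collIso_natural, Category.assoc, ← S.mu_naturality,
      ← S.map_comp_assoc, ← S.map_comp_assoc, collIso_map]
  · have n := α.naturality (collSnd T ht k X)
    simp only [Category.assoc]
    rw [collIso_app, collCompMap_snd, T.map_id, Category.comp_id, collAssocInv_snd, hμ,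
      ← S.map_comp_assoc, collIso_app, reassoc_of% n,
      reassoc_of% (collIso_app ht hα b hk (collComp T ht k X))]

/-- The `T`-operad structure on `K ≅ S1` given by a cartesian morphism of monads `α : S ⟶ T`. -/
noncomputable def operadOfCartesian : TOperad T ht k where
  mul := collMul ht hα b hk
  mul_over := collMul_over ht hα b hk hμ
  unit := collOne b
  unit_over := collOne_over b hk hη
  assoc := by
    -- Followed by `freeAct b`, this rewrites the right side as `S(collIso) ≫ μ ≫ freeAct b` after
    -- `collIso`; naturality of `collIso` gives the left side the same form with `S(freeAct b)` in
    -- place of `μ`, and the algebra law joins them.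
    have h := collIso_mult ht hα b hk hμ K
    have h' := congrArg (· ≫ freeAct b) h
    simp only [Category.assoc] at h'
    refine Eq.trans ?_ h'.symm
    have n := congrArg (· ≫ freeAct b) (collIso_natural ht hα b hk (collMul ht hα b hk))
    simp only [Category.assoc] at n
    refine n.trans ?_
    rw [collMul, S.map_comp]
    simp only [Category.assoc, freeAct_assoc]
  unit_mul := by
    have h := congrArg (· ≫ freeAct b) (collIso_unit ht hα b hk hη K)
    simp only [Category.assoc, unit_freeAct] at h
    exact h
  mul_unit := by
    -- At `X = 1` the identification `K ∘ 1 ≅ S1` is `b` itself, so the right unit law reduces to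
    -- that of `S` at `1`.
    have e : collRightInv T ht k ≫ (collIso ht hα b hk t).hom = b.hom := by
      have h := collIso_map ht hα b hk t
      rw [ht.hom_ext (ht.from t) (𝟙 t), S.map_id, Category.comp_id] at h
      rw [h, collRightInv, collLift_fst_assoc, Category.id_comp]
    rw [collMul, ← Category.assoc (collCompMap _ _ _ _ _), collIso_natural, Category.assoc,
      reassoc_of% e, freeAct, collOne, S.map_comp, Category.assoc, ← S.map_comp_assoc b.inv,
      b.inv_hom_id, S.map_id, Category.id_comp, S.right_unit_assoc, b.hom_inv_id]

/-- The monad induced by `operadOfCartesian` is isomorphic to `S`. -/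
noncomputable def inducedIso :
    (operadOfCartesian ht hα b hk hη hμ).inducedMonad ≅ S :=
  MonadIso.mk (NatIso.ofComponents (fun X => collIso ht hα b hk X)
      fun f => collIso_natural ht hα b hk f)
    (fun X => (Category.assoc _ _ _).trans (collIso_unit ht hα b hk hη X))
    (fun X => by
      refine (Category.assoc _ _ _).trans ((collIso_mult ht hα b hk hμ X).trans ?_)
      -- A morphism of monads applies the functor of the source to the component first, whereas
      -- `collIso_mult` applies that of `S` last; naturality exchanges the two orders.
      have h := (collIso_natural ht hα b hk (collIso ht hα b hk X).hom)
      exact (Category.assoc _ _ _).symm.trans (congrArg (· ≫ S.μ.app X) h.symm))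

end CartesianMorphism

/-! ### Pullbacks of categories -/

/-- Equalities of functors are strict here, while the objects involved often agree only
propositionally. Morphisms are therefore compared by `HEq`, which these lemmas propagate through
composition and functors. -/
theorem comp_heq_comp {Z : Type u} [Category.{v} Z] {x y z x' y' z' : Z} (hx : x = x')
    (hy : y = y') (hz : z = z') {f : x ⟶ y} {g : y ⟶ z} {f' : x' ⟶ y'} {g' : y' ⟶ z'}
    (hf : HEq f f') (hg : HEq g g') : HEq (f ≫ g) (f' ≫ g') := by
  subst hx hy hz
  rw [eq_of_heq hf, eq_of_heq hg]

theorem id_heq_id {Z : Type u} [Category.{v} Z] {x x' : Z} (hx : x = x') :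
    HEq (𝟙 x) (𝟙 x') := by
  subst hx; rfl

theorem conj_eqToHom_heq {Z : Type u} [Category.{v} Z] {x y x' y' : Z} (hx : x' = x) (hy : y = y')
    (f : x ⟶ y) : HEq (eqToHom hx ≫ f ≫ eqToHom hy) f := by
  subst hx hy; simp

theorem map_heq_map {X : Type u} [Category.{v} X] {Z : Type u'} [Category.{v'} Z] (F : X ⥤ Z)
    {x y x' y' : X} (hx : x = x') (hy : y = y') {f : x ⟶ y} {f' : x' ⟶ y'} (hf : HEq f f') :
    HEq (F.map f) (F.map f') := by
  subst hx hy
  rw [eq_of_heq hf]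

theorem map_heq_of_eq {X : Type u} [Category.{v} X] {Z : Type u'} [Category.{v'} Z] {F G : X ⥤ Z}
    (h : F = G) {x y : X} (f : x ⟶ y) : HEq (F.map f) (G.map f) := by
  subst h; rfl

namespace CategoryTheory.Cat

/-- Functors into `P` are equal if their composites with two jointly faithful functors which are
jointly injective on objects are. -/
theorem functor_ext_of_jointly_faithful {P X Y W : Type*} [Category* P] [Category* X] [Category* Y]
    [Category* W] {F : P ⥤ X} {G : P ⥤ Y}
    (hobj : ∀ p p', F.obj p = F.obj p' → G.obj p = G.obj p' → p = p')
    (hmap : ∀ (p p' : P) (φ ψ : p ⟶ p'), F.map φ = F.map ψ → G.map φ = G.map ψ → φ = ψ)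
    {L M : W ⥤ P} (h1 : L ⋙ F = M ⋙ F) (h2 : L ⋙ G = M ⋙ G) : L = M := by
  have ho : ∀ c, L.obj c = M.obj c := fun c =>
    hobj _ _ (Functor.congr_obj h1 c) (Functor.congr_obj h2 c)
  refine Functor.ext ho fun c d f => hmap _ _ _ _ ?_ ?_
  · exact eq_of_heq ((map_heq_of_eq h1 f).trans
      (map_heq_map F (ho c) (ho d) (conj_eqToHom_heq _ _ _)).symm)
  · exact eq_of_heq ((map_heq_of_eq h2 f).trans
      (map_heq_map G (ho c) (ho d) (conj_eqToHom_heq _ _ _)).symm)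

/-- Objects are lifted by choice. A morphism is lifted after conjugating its two images by `eqToHom`
to the chosen endpoints, and functoriality follows because `F` and `G` are jointly faithful. -/
theorem exists_lift_of_bijective {P X Y Z W : Type*} [Category* P] [Category* X] [Category* Y]
    [Category* Z] [Category* W] {F : P ⥤ X} {G : P ⥤ Y} {H : X ⥤ Z} {K : Y ⥤ Z}
    (hobj : ∀ x y, H.obj x = K.obj y → ∃ p, F.obj p = x ∧ G.obj p = y)
    (hmap : ∀ (p p' : P) (f : F.obj p ⟶ F.obj p') (g : G.obj p ⟶ G.obj p'),
      HEq (H.map f) (K.map g) → ∃ φ : p ⟶ p', F.map φ = f ∧ G.map φ = g)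
    (hmap' : ∀ (p p' : P) (φ ψ : p ⟶ p'), F.map φ = F.map ψ → G.map φ = G.map ψ → φ = ψ)
    (A : W ⥤ X) (B : W ⥤ Y) (w : A ⋙ H = B ⋙ K) : ∃ L : W ⥤ P, L ⋙ F = A ∧ L ⋙ G = B := by
  choose o o1 o2 using fun c => hobj _ _ (Functor.congr_obj w c)
  have hm : ∀ {c d} (f : c ⟶ d), ∃ φ : o c ⟶ o d,
      F.map φ = eqToHom (o1 c) ≫ A.map f ≫ eqToHom (o1 d).symm ∧
      G.map φ = eqToHom (o2 c) ≫ B.map f ≫ eqToHom (o2 d).symm := by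
    intro c d f
    refine hmap _ _ _ _ ?_
    refine (map_heq_map _ (o1 c) (o1 d) (conj_eqToHom_heq _ _ _)).trans ?_
    exact (map_heq_of_eq w f).trans (map_heq_map _ (o2 c) (o2 d) (conj_eqToHom_heq _ _ _)).symm
  choose m m1 m2 using @hm
  refine ⟨{ obj := o
            map f := m f
            map_id c := hmap' _ _ _ _ (by rw [m1]; simp) (by rw [m2]; simp)
            map_comp f g := hmap' _ _ _ _ (by simp [m1]) (by simp [m2]) }, ?_, ?_⟩
  · exact Functor.hext o1 fun c d f =>
      (heq_of_eq (m1 f)).trans (conj_eqToHom_heq (o1 c) (o1 d).symm _)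
  · exact Functor.hext o2 fun c d f =>
      (heq_of_eq (m2 f)).trans (conj_eqToHom_heq (o2 c) (o2 d).symm _)

/-- A commutative square of categories is a pullback if it is one on objects and on morphisms. -/
theorem isPullback_of_bijective {P X Y Z : Cat.{v, u}} {F : P ⟶ X} {G : P ⟶ Y} {H : X ⟶ Z}
    {K : Y ⟶ Z} (w : F ≫ H = G ≫ K)
    (hobj : ∀ x y, H.toFunctor.obj x = K.toFunctor.obj y →
      ∃ p, F.toFunctor.obj p = x ∧ G.toFunctor.obj p = y)
    (hobj' : ∀ p p', F.toFunctor.obj p = F.toFunctor.obj p' →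
      G.toFunctor.obj p = G.toFunctor.obj p' → p = p')
    (hmap : ∀ (p p' : P) (f : F.toFunctor.obj p ⟶ F.toFunctor.obj p')
      (g : G.toFunctor.obj p ⟶ G.toFunctor.obj p'),
      HEq (H.toFunctor.map f) (K.toFunctor.map g) →
      ∃ φ : p ⟶ p', F.toFunctor.map φ = f ∧ G.toFunctor.map φ = g)
    (hmap' : ∀ (p p' : P) (φ ψ : p ⟶ p'), F.toFunctor.map φ = F.toFunctor.map ψ →
      G.toFunctor.map φ = G.toFunctor.map ψ → φ = ψ) :
    IsPullback F G H K := by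
  choose L h1 h2 using fun s : PullbackCone H K =>
    exists_lift_of_bijective hobj hmap hmap' s.fst.toFunctor s.snd.toFunctor
      (congrArg Hom.toFunctor s.condition)
  refine ⟨⟨w⟩, ⟨PullbackCone.IsLimit.mk w (fun s => (⟨L s⟩ : s.pt ⟶ P))
    (fun s => Cat.ext (h1 s)) (fun s => Cat.ext (h2 s)) fun s m e1 e2 => Cat.ext ?_⟩⟩
  exact functor_ext_of_jointly_faithful hobj' hmap'
    ((congrArg Hom.toFunctor e1).trans (h1 s).symm) ((congrArg Hom.toFunctor e2).trans (h2 s).symm)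

end CategoryTheory.Cat

/-- The strict fibre product of two functors. -/
@[ext]
structure FibreProduct {X Y Z : Type u} [Category.{v} X] [Category.{v} Y] [Category.{v} Z]
    (H : X ⥤ Z) (K : Y ⥤ Z) : Type u where
  fst : X
  snd : Y
  eq : H.obj fst = K.obj snd

namespace FibreProduct

section
variable {X Y Z : Type u} [Category.{v} X] [Category.{v} Y] [Category.{v} Z]
  {H : X ⥤ Z} {K : Y ⥤ Z}

/-- Pairs of morphisms with the same image. -/
@[ext]
structure Hom (p q : FibreProduct H K) : Type v where
  fst : p.fst ⟶ q.fst
  snd : p.snd ⟶ q.snd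
  heq : HEq (H.map fst) (K.map snd)

instance : Category (FibreProduct H K) where
  Hom p q := Hom p q
  id p := ⟨𝟙 _, 𝟙 _, by simpa using id_heq_id p.eq⟩
  comp {p q r} f g := ⟨f.fst ≫ g.fst, f.snd ≫ g.snd, by
    simpa using comp_heq_comp p.eq q.eq r.eq f.heq g.heq⟩
  id_comp f := Hom.ext (Category.id_comp _) (Category.id_comp _)
  comp_id f := Hom.ext (Category.comp_id _) (Category.comp_id _)
  assoc f g h := Hom.ext (Category.assoc _ _ _) (Category.assoc _ _ _)

variable (H K)

/-- The projection to the first factor. -/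
def fstFunctor : FibreProduct H K ⥤ X where
  obj p := p.fst
  map f := Hom.fst f

/-- The projection to the second factor. -/
def sndFunctor : FibreProduct H K ⥤ Y where
  obj p := p.snd
  map f := Hom.snd f

theorem condition : fstFunctor H K ⋙ H = sndFunctor H K ⋙ K :=
  Functor.hext (fun p => p.eq) fun _ _ f => Hom.heq f

end

section
variable {X Y Z : Cat.{v, u}} (H : X ⟶ Z) (K : Y ⟶ Z)

/-- The first projection, as a morphism of `Cat`. -/
def fstHom : Cat.of (FibreProduct H.toFunctor K.toFunctor) ⟶ X := ⟨fstFunctor _ _⟩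

/-- The second projection, as a morphism of `Cat`. -/
def sndHom : Cat.of (FibreProduct H.toFunctor K.toFunctor) ⟶ Y := ⟨sndFunctor _ _⟩

/-- An explicit model of the pullback, to which `EΛ` can be applied entry by entry; the general case
follows by transport along an isomorphism. -/
theorem isPullback : IsPullback (fstHom H K) (sndHom H K) H K :=
  Cat.isPullback_of_bijective (Cat.ext (condition _ _)) (fun x y h => ⟨⟨x, y, h⟩, rfl, rfl⟩)
    (fun _ _ h1 h2 => FibreProduct.ext h1 h2) (fun _ _ f g h => ⟨⟨f, g, h⟩, rfl, rfl⟩)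
    fun _ _ _ _ h1 h2 => Hom.ext h1 h2

end

end FibreProduct

/-! ### The Borel construction is a cartesian monad -/

namespace BorelCat

variable {Λ : ActionOperad.{w}}

section
variable {X : Type u} [Category.{v} X]

theorem elt_heq {p q p' q' : BorelCat Λ X} (hp : p = p') (hq : q = q') {φ : p ⟶ q} {ψ : p' ⟶ q'}
    (h : HEq φ ψ) : HEq (Hom.elt φ) (Hom.elt ψ) := by
  subst hp hq; rw [eq_of_heq h]

theorem map_heq {p q p' q' : BorelCat Λ X} (hp : p = p') (hq : q = q') {φ : p ⟶ q} {ψ : p' ⟶ q'}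
    (h : HEq φ ψ) (i : Fin p.len) (j : Fin q.len) (i' : Fin p'.len) (j' : Fin q'.len)
    (hi : i.val = i'.val) (hj : j.val = j'.val) (h1) (h2) :
    HEq (Hom.map φ i j h1) (Hom.map ψ i' j' h2) := by
  subst hp hq
  obtain rfl := eq_of_heq h
  obtain rfl := Fin.ext hi
  obtain rfl := Fin.ext hj
  rfl

theorem map_heq' {p q : BorelCat Λ X} (φ : p ⟶ q) {i i' : Fin p.len} {j j' : Fin q.len}
    (hi : i = i') (hj : j = j') (h1) (h2) :
    HEq (Hom.map φ i j h1) (Hom.map φ i' j' h2) := by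
  subst hi hj; rfl

end

/-- A tuple of compatible pairs is a compatible pair of tuples of the same length. For morphisms,
agreement in `EΛ(Z)` forces the two group elements to coincide, and the entries then pair up. -/
theorem isPullback_fibreProduct {X Y Z : Cat.{max w u, max w u}} (H : X ⟶ Z) (K : Y ⟶ Z) :
    IsPullback
      ((borelMonad.{w, u} Λ).map (FibreProduct.fstHom H K))
      ((borelMonad.{w, u} Λ).map (FibreProduct.sndHom H K))
      ((borelMonad.{w, u} Λ).map H) ((borelMonad.{w, u} Λ).map K) := by
  refine Cat.isPullback_of_bijective ?_ ?_ ?_ ?_ ?_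
  · rw [← Functor.map_comp, ← Functor.map_comp, (FibreProduct.isPullback H K).w]
  · rintro ⟨n, x⟩ ⟨m, y⟩ h
    obtain ⟨h1, h2⟩ := (BorelCat.mk.injEq ..).mp h
    obtain rfl : n = m := h1
    exact ⟨⟨n, fun i => ⟨x i, y i, congrFun (eq_of_heq h2) i⟩⟩, rfl, rfl⟩
  · rintro ⟨n, x⟩ ⟨m, y⟩ h1 h2
    obtain ⟨h1, h3⟩ := (BorelCat.mk.injEq ..).mp h1
    obtain rfl : n = m := h1
    have h2 := ((BorelCat.mk.injEq ..).mp h2).2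
    exact obj_ext rfl fun i => FibreProduct.ext (congrFun (eq_of_heq h3) i)
      (congrFun (eq_of_heq h2) i)
  · intro p q (f : (⟨p.len, fun i => (p.pt i).fst⟩ : BorelCat Λ X) ⟶
      ⟨q.len, fun i => (q.pt i).fst⟩) (g : (⟨p.len, fun i => (p.pt i).snd⟩ : BorelCat Λ Y) ⟶
      ⟨q.len, fun i => (q.pt i).snd⟩) h
    -- The two images in `EΛ(Z)` agree only propositionally, so the components of `h` must be
    -- extracted along these equalities.
    have hp : ∀ p : BorelCat Λ (FibreProduct H.toFunctor K.toFunctor),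
        (⟨p.len, fun i => H.toFunctor.obj (p.pt i).fst⟩ : BorelCat Λ Z) =
          ⟨p.len, fun i => K.toFunctor.obj (p.pt i).snd⟩ := fun p =>
      obj_ext rfl fun i => (p.pt i).eq
    have he : Hom.elt f = Hom.elt g := eq_of_heq (elt_heq (hp p) (hp q) h)
    refine ⟨⟨(Hom.len_eq f :), (Hom.elt f :), fun i j h' => ⟨Hom.map f i j h', Hom.map g i j (he ▸ h'),
      map_heq (hp p) (hp q) h i j i j rfl rfl _ _⟩⟩, ?_, ?_⟩
    · rfl
    · exact Hom.ext' he fun _ _ _ _ => rfl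
  · intro p q φ ψ h1 h2
    exact Hom.ext' (congrArg Hom.elt h1 :) fun i j h _ =>
      FibreProduct.Hom.ext (map_congr h1 i j h :) (map_congr h2 i j h :)

theorem map_isPullback {P X Y Z : Cat.{max w u, max w u}} {p : P ⟶ X} {q : P ⟶ Y} {f : X ⟶ Z}
    {g : Y ⟶ Z} (h : IsPullback p q f g) :
    IsPullback ((borelMonad.{w, u} Λ).map p) ((borelMonad.{w, u} Λ).map q)
      ((borelMonad.{w, u} Λ).map f) ((borelMonad.{w, u} Λ).map g) := by
  let e := h.isoIsPullback _ _ (FibreProduct.isPullback f g)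
  refine (isPullback_fibreProduct f g).of_iso
    ((borelMonad.{w, u} Λ).toFunctor.mapIso e).symm (Iso.refl _)
    (Iso.refl _) (Iso.refl _) ?_ ?_ ?_ ?_
  · rw [Iso.symm_hom, Functor.mapIso_inv, ← Functor.map_comp, h.isoIsPullback_inv_fst]
    simp
  · rw [Iso.symm_hom, Functor.mapIso_inv, ← Functor.map_comp, h.isoIsPullback_inv_snd]
    simp
  · simp
  · simp

theorem unit_equifibered : (borelMonad.{w, u} Λ).η.Equifibered := by
  intro X Y F
  refine Cat.isPullback_of_bijective ((borelMonad.{w, u} Λ).η.naturality F) ?_ ?_ ?_ ?_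
  · rintro y ⟨m, x⟩ h
    obtain ⟨h1, h2⟩ := (BorelCat.mk.injEq ..).mp h
    obtain rfl : 1 = m := h1
    exact ⟨x 0, (congrFun (eq_of_heq h2) 0).symm,
      obj_ext rfl fun i => congrArg x (Subsingleton.elim (0 : Fin 1) i)⟩
  · intro p p' _ h2
    exact congrFun (eq_of_heq ((BorelCat.mk.injEq ..).mp h2).2) 0
  · intro p p' f g h
    -- Morphisms in the image of the unit have group element `1`, so only the single entry of `g` is
    -- left to lift.
    have he : 1 = Hom.elt g := congrArg Hom.elt (eq_of_heq h)
    refine ⟨Hom.map g (0 : Fin 1) (0 : Fin 1) (by rw [← he]; change (0 : Fin 1).val = (Λ.pi 1 1 0).val; simp), ?_, ?_⟩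
    · exact (map_congr (eq_of_heq h) (0 : Fin 1) (0 : Fin 1)
        (by change _ = (Λ.pi 1 1 0).val; simp)).symm
    · refine Hom.ext' he fun i j h1 h2 => ?_
      obtain rfl : i = (0 : Fin 1) := Subsingleton.elim (α := Fin 1) _ _
      obtain rfl : j = (0 : Fin 1) := Subsingleton.elim (α := Fin 1) _ _
      rfl
  · intro p p' φ ψ _ h2
    exact map_congr h2 (0 : Fin 1) (0 : Fin 1) (by change _ = (Λ.pi 1 1 0).val; simp)

/-- A morphism of `EΛ(X)` is a morphism of `EΣ(X)` together with a lift of its permutation to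
`Λ(n)`. The lift does not involve `X`, so it can be supplied from `EΛ(Y)`. -/
theorem comparison_equifibered : (comparison.{w, u} Λ).Equifibered := by
  intro X Y F
  refine Cat.isPullback_of_bijective ((comparison.{w, u} Λ).naturality F) ?_ ?_ ?_ ?_
  · rintro ⟨n, y⟩ ⟨m, x⟩ h
    obtain ⟨h1, h2⟩ := (BorelCat.mk.injEq ..).mp h
    obtain rfl : n = m := h1
    obtain rfl := eq_of_heq h2
    exact ⟨⟨n, x⟩, rfl, rfl⟩
  · rintro ⟨n, y⟩ ⟨m, x⟩ _ h
    obtain ⟨h1, h2⟩ := (BorelCat.mk.injEq ..).mp h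
    obtain rfl : n = m := h1
    obtain rfl := eq_of_heq h2
    rfl
  · intro p p' (f : (⟨p.len, fun i => F.toFunctor.obj (p.pt i)⟩ : BorelCat Λ Y) ⟶
      ⟨p'.len, fun i => F.toFunctor.obj (p'.pt i)⟩) (g : (⟨p.len, p.pt⟩ : BorelCat symmOperad X) ⟶
      ⟨p'.len, p'.pt⟩) h
    have he : Λ.pi _ (Hom.elt f) = Hom.elt g := congrArg Hom.elt (eq_of_heq h)
    refine ⟨⟨(Hom.len_eq f :), (Hom.elt f :), fun i j h' => Hom.map g i j ?_⟩, ?_, ?_⟩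
    · rw [← he]; exact h'
    · refine Hom.ext' rfl fun i j h1 h2 => ?_
      exact (map_congr (eq_of_heq h) i j h2).symm
    · exact Hom.ext' he fun _ _ _ _ => rfl
  · intro p p' φ ψ h1 h2
    exact Hom.ext' (congrArg Hom.elt h1 :) fun i j h _ => map_congr h2 i j h

theorem comparison_unit (X : Cat.{max w u, max w u}) :
    (borelMonad.{w, u} Λ).η.app X ≫ (comparison.{w, u} Λ).app X =
      symmMonad.{max w u}.η.app X :=
  Cat.ext (Functor.hext (fun _ => rfl) fun _ _ _ => heq_of_eq
    (Hom.ext' (map_one (Λ.pi 1)) fun _ _ _ _ => rfl))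

/-- On group elements this says that `π` is a map of operads; the entries agree by definition. -/
theorem comparison_mult (X : Cat.{max w u, max w u}) :
    (borelMonad.{w, u} Λ).μ.app X ≫ (comparison.{w, u} Λ).app X =
      (borelMonad.{w, u} Λ).map ((comparison.{w, u} Λ).app X) ≫
        (comparison.{w, u} Λ).app (symmMonad.{max w u}.obj X) ≫ symmMonad.{max w u}.μ.app X :=
  Cat.ext (Functor.hext (fun _ => rfl) fun _ _ _ => heq_of_eq
    (Hom.ext' (Λ.pi_mul _ _) fun _ _ _ _ => rfl))

end BorelCat

/-! ### Cartesianness of the multiplication -/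

namespace BorelCat

variable {Λ : ActionOperad.{w}}

section
variable {X : Type u} [Category.{v} X]

theorem pt_congr {p q : BorelCat Λ X} (h : p = q) (i : Fin p.len) (j : Fin q.len)
    (hij : i.val = j.val) : p.pt i = q.pt j := by
  subst h
  rw [Fin.ext hij]

theorem flat_pt (p : BorelCat Λ (BorelCat Λ X)) (i : Fin p.len) (a : Fin (p.pt i).len) :
    (flat p).pt (finSigmaFinEquiv (n := fun i => (p.pt i).len) ⟨i, a⟩) = (p.pt i).pt a :=
  congrArg (fun s : Σ i, Fin (p.pt i).len => (p.pt s.1).pt s.2) (Equiv.symm_apply_apply _ _)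

/-- `flatHom` decodes a position by the inverse of `finSigmaFinEquiv`; this evaluates it at encoded
positions `(i, a)`, where decoding returns the pair only propositionally. -/
theorem flatHom_map {p q : BorelCat Λ (BorelCat Λ X)} (φ : p ⟶ q) (i : Fin p.len)
    (a : Fin (p.pt i).len) (j : Fin q.len) (b : Fin (q.pt j).len) (h1) (h2) (h3) :
    HEq (Hom.map (flatHom φ) (finSigmaFinEquiv (n := fun i => (p.pt i).len) ⟨i, a⟩)
      (finSigmaFinEquiv (n := fun j => (q.pt j).len) ⟨j, b⟩) h1)
      (Hom.map (Hom.map φ i j h2) a b h3) := by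
  have key : ∀ (s s' : Σ i, Fin (p.pt i).len) (t t' : Σ j, Fin (q.pt j).len), s = s' → t = t' →
      ∀ h1 h2 h1' h2', HEq (Hom.map (Hom.map φ s.1 t.1 h1) s.2 t.2 h2)
        (Hom.map (Hom.map φ s'.1 t'.1 h1') s'.2 t'.2 h2') := by
    rintro s _ t _ rfl rfl _ _ _ _; rfl
  exact key _ ⟨i, a⟩ _ ⟨j, b⟩ (Equiv.symm_apply_apply _ _) (Equiv.symm_apply_apply _ _) _ _ _ _

end

/-- A tuple of tuples amounts to its block lengths and its concatenation. A morphism of `EΛ(EΛ(X))`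
amounts to its outer and inner group elements and the family of its innermost entries. Lengths and
group elements survive in `EΛ(EΛ(Y))`, while the entries are recovered from `EΛ(X)`. -/
theorem mult_equifibered : (borelMonad.{w, u} Λ).μ.Equifibered := by
  intro X Y F
  refine Cat.isPullback_of_bijective ((borelMonad.{w, u} Λ).μ.naturality F) ?_ ?_ ?_ ?_
  · rintro (P : BorelCat Λ (BorelCat Λ Y)) ⟨m, x⟩ h
    obtain ⟨h1, h2⟩ := (BorelCat.mk.injEq ..).mp h
    subst h1
    have h2 := eq_of_heq h2
    refine ⟨⟨P.len, fun i => ⟨(P.pt i).len, fun a => x (finSigmaFinEquiv ⟨i, a⟩)⟩⟩, ?_, ?_⟩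
    · exact obj_ext rfl fun i => obj_ext rfl fun a =>
        (congrFun h2 (finSigmaFinEquiv ⟨i, a⟩)).symm.trans (flat_pt P i a)
    · exact obj_ext rfl fun a => congrArg x (Equiv.apply_symm_apply finSigmaFinEquiv a)
  · rintro ⟨n, x⟩ ⟨m, x'⟩ h1 h2
    obtain ⟨h, h1⟩ := (BorelCat.mk.injEq ..).mp h1
    obtain rfl : n = m := h
    -- Equality over `Y` fixes the block lengths; equality of the concatenations then gives the
    -- entries.
    have hl : ∀ i, (x i).len = (x' i).len := fun i =>
      (congrArg BorelCat.len (congrFun (eq_of_heq h1) i) :)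
    refine obj_ext rfl fun i => obj_ext (hl i) fun a => ?_
    refine (flat_pt ⟨n, x⟩ i a).symm.trans (Eq.trans ?_ (flat_pt ⟨n, x'⟩ i (Fin.cast (hl i) a)))
    refine pt_congr h2 _ _ (finSigma_val_congr rfl ?_ rfl rfl)
    intro j j' hj
    obtain rfl := Fin.ext hj
    exact hl j
  · intro p p' (f : (⟨p.len, fun i => ⟨(p.pt i).len, fun a => F.toFunctor.obj ((p.pt i).pt a)⟩⟩ :
      BorelCat Λ (BorelCat Λ Y)) ⟶
      ⟨p'.len, fun i => ⟨(p'.pt i).len, fun a => F.toFunctor.obj ((p'.pt i).pt a)⟩⟩)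
      (g : flat p ⟶ flat p') h
    have h : flatHom f = (mapFunctor F.toFunctor).map g := eq_of_heq h
    have he : Hom.elt (flatHom f) = Hom.elt g := congrArg Hom.elt h
    have hi : ∀ (i : Fin p.len) (j : Fin p'.len) (a : Fin (p.pt i).len) (b : Fin (p'.pt j).len)
        (h1 : j.val = (Λ.pi _ (Hom.elt f) i).val)
        (_ : b.val = (Λ.pi _ (Hom.elt (Hom.map f i j h1)) a).val),
        (finSigmaFinEquiv (n := fun j => (p'.pt j).len) ⟨j, b⟩).val =
          (Λ.pi _ (Hom.elt g) (finSigmaFinEquiv (n := fun i => (p.pt i).len) ⟨i, a⟩)).val := by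
      intro i j a b h1 h2
      rw [← he]
      exact (flat_index f i a j b).mpr ⟨h1, by rw [innerElt_eq f i j h1]; exact h2⟩
    -- Both layers of group elements come from `f`, the entries from `g` at the encoded positions.
    -- The conjugation is needed because `flat_pt` is only a propositional equality.
    let φ : p ⟶ p' := ⟨(Hom.len_eq f :), (Hom.elt f :), fun i j h1 =>
      ⟨(Hom.len_eq (Hom.map f i j h1) :), (Hom.elt (Hom.map f i j h1) :), fun a b h2 =>
        eqToHom (flat_pt p i a).symm ≫ Hom.map g (finSigmaFinEquiv ⟨i, a⟩)
          (finSigmaFinEquiv ⟨j, b⟩) (hi i j a b h1 h2) ≫ eqToHom (flat_pt p' j b)⟩⟩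
    refine ⟨φ, ?_, ?_⟩
    · refine Hom.ext' rfl fun i j h1 _ => Hom.ext' rfl fun a b h2 _ => eq_of_heq ?_
      refine (map_heq_map F.toFunctor (flat_pt p i a).symm (flat_pt p' j b).symm
        (conj_eqToHom_heq _ _ _)).trans ?_
      refine HEq.trans (heq_of_eq ?_) (flatHom_map f i a j b ?_ h1 h2)
      · exact (map_congr h _ _ _).symm
      · rw [he]; exact hi i j a b h1 h2
    · refine Hom.ext' he fun A B h1 h2 => ?_
      obtain ⟨⟨i, a⟩, rfl⟩ := (finSigmaFinEquiv (n := fun i => (p.pt i).len)).surjective A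
      obtain ⟨⟨j, b⟩, rfl⟩ := (finSigmaFinEquiv (n := fun i => (p'.pt i).len)).surjective B
      have h3 := (flat_index φ i a j b).mp h1
      have h4 := h3.2
      rw [innerElt_eq φ i j h3.1] at h4
      exact eq_of_heq ((flatHom_map φ i a j b h1 h3.1 h4).trans (conj_eqToHom_heq _ _ _))
  · intro p p' φ ψ h1 h2
    refine Hom.ext' (congrArg Hom.elt h1 :) fun i j h3 _ => ?_
    refine Hom.ext' (congrArg Hom.elt (map_congr h1 i j h3) :) fun a b h4 _ => ?_
    have h5 := (flat_index φ i a j b).mpr ⟨h3, by rw [innerElt_eq φ i j h3]; exact h4⟩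
    exact eq_of_heq ((flatHom_map φ i a j b h5 h3 h4).symm.trans
      ((heq_of_eq (map_congr h2 _ _ h5)).trans (flatHom_map ψ i a j b _ _ _)))

theorem isCartesianMonad (Λ : ActionOperad.{w}) : IsCartesianMonad (borelMonad.{w, u} Λ) :=
  ⟨map_isPullback, unit_equifibered, mult_equifibered⟩

end BorelCat

/-! ### The quotient functors `EΛ(n) × Xⁿ ⥤ EΛ(X)` -/

theorem ActionOperad.pi_mul_inv_apply (Λ : ActionOperad.{w}) {n : ℕ} (g h : Λ.carrier n)
    (i : Fin n) : (Λ.pi n (g * h))⁻¹ i = (Λ.pi n h)⁻¹ ((Λ.pi n g)⁻¹ i) := by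
  rw [map_mul, mul_inv_rev]; rfl

theorem ActionOperad.pi_one_inv_apply (Λ : ActionOperad.{w}) {n : ℕ} (i : Fin n) :
    (Λ.pi n 1)⁻¹ i = i := by
  rw [map_one]; rfl

namespace EPow

section
variable {Λ : ActionOperad.{w}} {X : Type u} [Category.{v} X] {n : ℕ}

theorem obj_ext {p q : EPow Λ n X} (h : p.1.as = q.1.as) (hx : ∀ i, p.2 i = q.2 i) : p = q :=
  Prod.ext (Codiscrete.ext h) (funext hx)

theorem hom_heq {p q p' q' : EPow Λ n X} (hp : p = p') (hq : q = q') {f : p ⟶ q} {f' : p' ⟶ q'}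
    (h : ∀ i, HEq (f.2 i) (f'.2 i)) : HEq f f' := by
  subst hp hq
  exact heq_of_eq (Prod.ext rfl (funext fun i => eq_of_heq (h i)))

theorem snd_heq {p q : EPow Λ n X} (f : p ⟶ q) {i j : Fin n} (h : i = j) :
    HEq (f.2 i) (f.2 j) := by
  subst h; rfl

theorem quot_map_heq {p q : EPow Λ n X} (f : p ⟶ q) (i j : Fin n) (h) (i' : Fin n)
    (hi : (Λ.pi n p.1.as)⁻¹ i = i') :
    HEq (BorelCat.Hom.map ((quot Λ X n).map f) i j h) (f.2 i') :=
  (comp_eqToHom_heq _ _).trans (snd_heq f hi)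

-- Both functors read entries through `π(gh)⁻¹ = π(h)⁻¹π(g)⁻¹`, and on morphisms `(g'h)(gh)⁻¹ =
-- g'g⁻¹`.
variable (Λ X) in
theorem rightAct_comp_quot (h : Λ.carrier n) :
    rightAct Λ X h ⋙ quot Λ X n = leftAct Λ X h ⋙ quot Λ X n := by
  have ho : ∀ p, (rightAct Λ X h ⋙ quot Λ X n).obj p = (leftAct Λ X h ⋙ quot Λ X n).obj p :=
    fun p => BorelCat.obj_ext rfl fun i => congrArg p.2 (Λ.pi_mul_inv_apply _ _ i)
  refine Functor.hext ho fun p q f => BorelCat.hom_heq (ho p) (ho q) ⟨rfl, ?_⟩ ?_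
  · change (q.1.as * h) * (p.1.as * h)⁻¹ = q.1.as * p.1.as⁻¹
    group
  · intro i j i' j' h1 h2 hi hj
    obtain rfl : i = i' := Fin.ext hi
    refine (quot_map_heq _ _ _ _ _ rfl).trans (HEq.trans ?_ (quot_map_heq _ _ _ _ _ rfl).symm)
    exact snd_heq f (Λ.pi_mul_inv_apply _ _ i)

end

/-! ### Representatives with source over the identity element -/

section
variable {Λ : ActionOperad.{w}} {X : Type u} [Category.{v} X]

/-- The representative `(e; x₁, …, xₙ)` of an object of `EΛ(X)`. -/
def repObj (p : BorelCat Λ X) : EPow Λ p.len X := (⟨1⟩, p.pt)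

/-- The target of the representative of a morphism of `EΛ(X)`. -/
def repTgt {p q : BorelCat Λ X} (φ : p ⟶ q) : EPow Λ p.len X :=
  (⟨BorelCat.Hom.elt φ⟩,
    fun i => q.pt (Fin.cast (BorelCat.Hom.len_eq φ) (Λ.pi _ (BorelCat.Hom.elt φ) i)))

/-- The representative of a morphism of `EΛ(X)` with source `(e; x₁, …, xₙ)`. -/
def repHom {p q : BorelCat Λ X} (φ : p ⟶ q) : repObj p ⟶ repTgt φ :=
  ⟨(), fun i => BorelCat.Hom.map φ i _ rfl⟩

theorem quot_repObj (p : BorelCat Λ X) : (quot Λ X p.len).obj (repObj p) = p :=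
  BorelCat.obj_ext rfl fun i => congrArg p.pt (Λ.pi_one_inv_apply i)

theorem quot_repTgt {p q : BorelCat Λ X} (φ : p ⟶ q) :
    (quot Λ X p.len).obj (repTgt φ) = q :=
  BorelCat.obj_ext (BorelCat.Hom.len_eq φ :) fun i => congrArg q.pt (congrArg
    (Fin.cast (BorelCat.Hom.len_eq φ)) (Equiv.apply_symm_apply (Λ.pi _ (BorelCat.Hom.elt φ)) i))

theorem quot_repHom {p q : BorelCat Λ X} (φ : p ⟶ q) :
    HEq ((quot Λ X p.len).map (repHom φ)) φ := by
  refine BorelCat.hom_heq (quot_repObj p) (quot_repTgt φ) ⟨rfl, ?_⟩ ?_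
  · change BorelCat.Hom.elt φ * 1⁻¹ = _
    simp
  · intro i j i' j' h1 h2 hi hj
    obtain rfl : i = i' := Fin.ext hi
    refine (quot_map_heq _ _ _ _ i (Λ.pi_one_inv_apply i)).trans ?_
    exact BorelCat.map_heq' φ rfl (Fin.ext h2.symm) _ _

/-- Every object and every single morphism of `EΛ(X)` is the image of a representative under some
`quot`. This gives uniqueness in the universal property. -/
theorem quot_jointly_epi {D : Type u'} [Category.{v'} D] {G G' : BorelCat Λ X ⥤ D}
    (h : ∀ n, quot Λ X n ⋙ G = quot Λ X n ⋙ G') : G = G' := by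
  have ho : ∀ p, G.obj p = G'.obj p := fun p => by
    have := Functor.congr_obj (h p.len) (repObj p)
    rw [Functor.comp_obj, Functor.comp_obj, quot_repObj] at this
    exact this
  refine Functor.hext ho fun p q φ => ?_
  refine (map_heq_map G (quot_repObj p) (quot_repTgt φ) (quot_repHom φ)).symm.trans ?_
  exact (map_heq_of_eq (h p.len) (repHom φ)).trans
    (map_heq_map G' (quot_repObj p) (quot_repTgt φ) (quot_repHom φ))

end

/-! ### The universal property of the quotient -/

section
variable {Λ : ActionOperad.{w}} {X : Type u} [Category.{v} X] {D : Type u'} [Category.{v'} D]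
  {F : ∀ n, EPow Λ n X ⥤ D}
  (hF : ∀ (n : ℕ) (h : Λ.carrier n), rightAct Λ X h ⋙ F n = leftAct Λ X h ⋙ F n)

include hF

/-- `(g; x)` is the right translate of `(e; x)` by `g`, and invariance replaces this by the left
translate, which is the normal form of `(g; x)`. -/
theorem invariant_obj {n : ℕ} (p : EPow Λ n X) :
    (F n).obj p = (F n).obj (repObj ((quot Λ X n).obj p)) := by
  refine Eq.trans ?_ (Functor.congr_obj (hF n p.1.as) (⟨1⟩, p.2))
  exact congrArg (F n).obj (obj_ext (one_mul _).symm fun _ => rfl)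

/-- A morphism `(g; x) ⟶ (g'; x')` is the right translate by `g` of a morphism `(e; x) ⟶ (g'g⁻¹;
x')`, whose left translate by `g` is `f'`. The endpoints of `f'` are constrained only by equations,
so that representatives can be substituted for it. -/
theorem invariant_map {n : ℕ} {p q p' q' : EPow Λ n X} (f : p ⟶ q) (f' : p' ⟶ q')
    (h1 : p'.1.as = 1) (h2 : q'.1.as * p.1.as = q.1.as)
    (hp : ∀ i, p'.2 i = p.2 ((Λ.pi n p.1.as)⁻¹ i)) (hq : ∀ i, q'.2 i = q.2 ((Λ.pi n p.1.as)⁻¹ i))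
    (hf : ∀ i, HEq (f'.2 i) (f.2 ((Λ.pi n p.1.as)⁻¹ i))) :
    HEq ((F n).map f) ((F n).map f') := by
  let γ : ((⟨p'.1.as⟩, p.2) : EPow Λ n X) ⟶ (⟨q'.1.as⟩, q.2) := ⟨(), f.2⟩
  have e1 : p = (rightAct Λ X p.1.as).obj (⟨p'.1.as⟩, p.2) :=
    obj_ext (by change _ = p'.1.as * p.1.as; rw [h1, one_mul]) fun _ => rfl
  have e2 : q = (rightAct Λ X p.1.as).obj (⟨q'.1.as⟩, q.2) := obj_ext h2.symm fun _ => rfl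
  have e3 : (leftAct Λ X p.1.as).obj (⟨p'.1.as⟩, p.2) = p' := obj_ext rfl fun i => (hp i).symm
  have e4 : (leftAct Λ X p.1.as).obj (⟨q'.1.as⟩, q.2) = q' := obj_ext rfl fun i => (hq i).symm
  refine (map_heq_map (F n) e1 e2 (hom_heq (f' := (rightAct Λ X p.1.as).map γ) e1 e2
    fun i => HEq.rfl)).trans ((map_heq_of_eq (hF n p.1.as) γ).trans ?_)
  exact map_heq_map (F n) e3 e4 (hom_heq e3 e4 fun i => (hf i).symm)

theorem invariant_repTgt {p q : BorelCat Λ X} (φ : p ⟶ q) :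
    (F p.len).obj (repTgt φ) = (F q.len).obj (repObj q) :=
  (invariant_obj hF (repTgt φ)).trans
    (congrArg (fun q : BorelCat Λ X => (F q.len).obj (repObj q)) (quot_repTgt φ))

/-- The functor on `EΛ(X)` induced by invariant functors on the `EΛ(n) × Xⁿ`. -/
def descend : BorelCat Λ X ⥤ D where
  obj p := (F p.len).obj (repObj p)
  map {p q} φ := (F p.len).map (repHom φ) ≫ eqToHom (invariant_repTgt hF φ)
  map_id p := by
    refine eq_of_heq ((comp_eqToHom_heq _ _).trans ?_)
    rw [← (F p.len).map_id]
    -- The representative of an identity is an endomorphism of `(e; x)`, since its group element is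
    -- `1`.
    have e : repTgt (𝟙 p) = repObj p := obj_ext rfl fun i => congrArg p.pt (by
      ext; simp [BorelCat.id_elt])
    refine map_heq_map _ rfl e (hom_heq rfl e fun i => ?_)
    exact BorelCat.map_heq' (𝟙 p) (i' := i) (j' := i) rfl (by ext; simp [BorelCat.id_elt]) rfl
      (by simp [BorelCat.id_elt])
  map_comp {p q r} φ ψ := by
    obtain ⟨n, x⟩ := p
    obtain ⟨m, y⟩ := q
    obtain ⟨k, z⟩ := r
    obtain rfl : n = m := BorelCat.Hom.len_eq φ
    obtain rfl : n = k := BorelCat.Hom.len_eq ψ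
    let g : Λ.carrier n := BorelCat.Hom.elt φ
    have hg : ∀ i : Fin n, (Λ.pi n (BorelCat.Hom.elt (φ ≫ ψ)) i) =
        Λ.pi n (BorelCat.Hom.elt ψ) (Λ.pi n g i) := fun i => by
      rw [BorelCat.comp_elt, map_mul]; rfl
    -- The representatives of `φ` and `ψ` are not composable, since the second starts over `e` and
    -- the first ends over `g`. `β` is the translate of the second that starts where the first ends;
    -- by invariance `F` does not distinguish it from `repHom ψ`.
    let β : repTgt φ ⟶ repTgt (φ ≫ ψ) :=
      ⟨(), fun i => BorelCat.Hom.map ψ (Λ.pi n g i) _ (congrArg Fin.val (hg i))⟩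
    have e : repHom (φ ≫ ψ) = repHom φ ≫ β := Prod.ext rfl (funext fun i =>
      BorelCat.comp_map φ ψ _ _ _ rfl rfl (congrArg Fin.val (hg i)))
    have hβ : HEq ((F n).map β) ((F n).map (repHom ψ)) := by
      refine invariant_map hF β (repHom ψ) rfl rfl (fun i => ?_) (fun i => ?_) fun i => ?_
      · exact congrArg y (by simp [repTgt])
      · refine congrArg z (Fin.ext ?_)
        exact congrArg Fin.val (((hg _).trans (by simp [repTgt, g])).symm)
      · refine BorelCat.map_heq' ψ ?_ (Fin.ext ?_) _ _
        · simp [repTgt, g]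
        · exact congrArg Fin.val (((hg _).trans (by simp [repTgt, g])).symm)
    refine eq_of_heq ((comp_eqToHom_heq _ _).trans ?_)
    rw [e, Functor.map_comp, Category.assoc]
    refine comp_heq_comp rfl rfl (invariant_repTgt hF _) HEq.rfl ?_
    refine hβ.trans (HEq.symm ?_)
    exact (eqToHom_comp_heq _ _).trans (comp_eqToHom_heq _ _)

theorem quot_comp_descend (n : ℕ) : quot Λ X n ⋙ descend hF = F n := by
  refine Functor.hext (fun p => (invariant_obj hF p).symm) fun p q f => ?_
  refine (comp_eqToHom_heq _ _).trans (invariant_map hF f (repHom ((quot Λ X n).map f)) rfl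
    (inv_mul_cancel_right _ _) (fun i => rfl) (fun i => ?_) fun i => ?_).symm
  · refine congrArg q.2 ?_
    change (Λ.pi n q.1.as)⁻¹ (Λ.pi n (q.1.as * p.1.as⁻¹) i) = _
    simp
  · exact quot_map_heq f _ _ rfl _ rfl

end
end EPow

/-! ### Compatibility of the quotient functors with functoriality, unit and multiplication -/

theorem blockPerm_inv_apply {n : ℕ} {k : Fin n → ℕ} (σ : Equiv.Perm (Fin n))
    (τ : ∀ i, Equiv.Perm (Fin (k i))) (i : Fin n) (b : Fin (k (σ⁻¹ i)))
    (h : ∑ i, k (σ⁻¹ i) = ∑ i, k i) :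
    (blockPerm σ τ)⁻¹ (Fin.cast h (finSigmaFinEquiv (n := fun i => k (σ⁻¹ i)) ⟨i, b⟩)) =
      finSigmaFinEquiv ⟨σ⁻¹ i, (τ (σ⁻¹ i))⁻¹ b⟩ := by
  rw [Equiv.Perm.inv_eq_iff_eq]
  ext
  rw [blockPerm_apply (k' := fun i => k (σ⁻¹ i)) σ τ (fun i => congrArg k (σ.symm_apply_apply i))]
  refine finSigma_val_congr (k := fun i => k (σ⁻¹ i)) (l := fun i => k (σ⁻¹ i)) (p := ⟨i, b⟩)
    (q := ⟨σ (σ⁻¹ i), _⟩) rfl (fun x y hxy => by rw [Fin.ext hxy]) (congrArg Fin.val (σ.apply_symm_apply i).symm) ?_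
  exact congrArg Fin.val ((τ _).apply_symm_apply b).symm

namespace BorelCat

variable {Λ : ActionOperad.{w}} {X : Type u} [Category.{v} X]

theorem flat_index_elt {p q : BorelCat Λ (BorelCat Λ X)} (φ : p ⟶ q) (i : Fin p.len)
    (a : Fin (p.pt i).len) (j : Fin q.len) (b : Fin (q.pt j).len)
    (h : (finSigmaFinEquiv (n := fun j => (q.pt j).len) ⟨j, b⟩).val =
      (Λ.pi _ (Hom.elt (flatHom φ)) (finSigmaFinEquiv (n := fun i => (p.pt i).len) ⟨i, a⟩)).val) :
    ∃ h1 : j.val = (Λ.pi _ (Hom.elt φ) i).val,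
      b.val = (Λ.pi _ (Hom.elt (Hom.map φ i j h1)) a).val := by
  obtain ⟨h1, h2⟩ := (flat_index φ i a j b).mp h
  exact ⟨h1, by rw [← innerElt_eq φ i j h1]; exact h2⟩

theorem elt_comp_eqToHom {p q r : BorelCat Λ X} (φ : p ⟶ q) (h : q = r) :
    Hom.elt (φ ≫ eqToHom h) = Hom.elt φ := by
  subst h; simp

theorem map_comp_eqToHom_heq {p q r : BorelCat Λ X} (φ : p ⟶ q) (h : q = r) (i : Fin p.len)
    (j : Fin r.len) (j' : Fin q.len) (hj : j.val = j'.val) (h1) (h2) :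
    HEq (Hom.map (φ ≫ eqToHom h) i j h1) (Hom.map φ i j' h2) := by
  subst h
  obtain rfl := Fin.ext hj
  exact heq_of_eq (map_congr (Category.comp_id φ) _ _ _)

end BorelCat

namespace EPow

section
variable {Λ : ActionOperad.{w}} {X : Type u} [Category.{v} X]

variable (Λ X) in
theorem unit_comp_quot : unit Λ X ⋙ quot Λ X 1 = BorelCat.unitFunctor Λ X :=
  Functor.hext (fun _ => rfl) fun _ _ f => heq_of_eq (BorelCat.Hom.ext' (mul_inv_cancel _)
    fun _ _ _ _ => Category.comp_id f)

theorem prod_map_comp_quot {Y : Type u'} [Category.{v'} Y] (F : X ⥤ Y) (n : ℕ) :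
    (𝟭 (Codiscrete (Λ.carrier n))).prod (Functor.pi fun _ => F) ⋙ quot Λ Y n =
      quot Λ X n ⋙ BorelCat.mapFunctor F :=
  Functor.hext (fun _ => rfl) fun _ _ f => heq_of_eq (BorelCat.Hom.ext' rfl
    fun _ _ _ _ => by
      change F.map _ ≫ _ = F.map (_ ≫ _)
      rw [F.map_comp, eqToHom_map]
      rfl)

/-- The functor `EΛ(n) × ∏ᵢ (EΛ(kᵢ) × X^{kᵢ}) ⥤ EΛ(EΛ(X))`. -/
abbrev quotQuot (Λ : ActionOperad.{w}) (X : Type u) [Category.{v} X] {n : ℕ} (k : Fin n → ℕ) :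
    Codiscrete (Λ.carrier n) × (∀ i, EPow Λ (k i) X) ⥤ BorelCat Λ (BorelCat Λ X) :=
  (𝟭 (Codiscrete (Λ.carrier n))).prod (Functor.pi fun i => quot Λ X (k i)) ⋙
    quot Λ (BorelCat Λ X) n

variable {n : ℕ} {k : Fin n → ℕ}

theorem concat_obj_pt (p : Codiscrete (Λ.carrier n) × (∀ i, EPow Λ (k i) X)) (i : Fin n)
    (a : Fin (k i)) :
    ((concat Λ X k).obj p).2 (finSigmaFinEquiv ⟨i, a⟩) = (p.2 i).2 a :=
  congrArg (fun s : Σ i, Fin (k i) => (p.2 s.1).2 s.2) (Equiv.symm_apply_apply _ _)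

theorem concat_map_heq {p q : Codiscrete (Λ.carrier n) × (∀ i, EPow Λ (k i) X)} (f : p ⟶ q)
    (i : Fin n) (a : Fin (k i)) :
    HEq (((concat Λ X k).map f).2 (finSigmaFinEquiv ⟨i, a⟩)) ((f.2 i).2 a) := by
  have key : ∀ s s' : Σ i, Fin (k i), s = s' → HEq ((f.2 s.1).2 s.2) ((f.2 s'.1).2 s'.2) := by
    rintro s _ rfl; rfl
  exact key _ ⟨i, a⟩ (Equiv.symm_apply_apply _ _)

theorem sum_pi_inv (g : Λ.carrier n) : ∑ i, k ((Λ.pi n g)⁻¹ i) = ∑ i, k i :=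
  Equiv.sum_comp (Λ.pi n g)⁻¹ k

/-- Normalising a concatenation reads its entries through the inverse of a block permutation. That
inverse acts on the blocks by the outer inverse and within a block by the inner one, which is the
effect of normalising the outer and the inner tuples separately. -/
theorem concat_index (p : Codiscrete (Λ.carrier n) × (∀ i, EPow Λ (k i) X)) (i : Fin n)
    (b : Fin (k ((Λ.pi n p.1.as)⁻¹ i))) :
    (Λ.pi _ ((concat Λ X k).obj p).1.as)⁻¹ (Fin.cast (sum_pi_inv p.1.as)
      (finSigmaFinEquiv (n := fun i => k ((Λ.pi n p.1.as)⁻¹ i)) ⟨i, b⟩)) =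
      finSigmaFinEquiv ⟨(Λ.pi n p.1.as)⁻¹ i, (Λ.pi _ (p.2 ((Λ.pi n p.1.as)⁻¹ i)).1.as)⁻¹ b⟩ := by
  change (Λ.pi _ (Λ.mul p.1.as fun i => (p.2 i).1.as))⁻¹ _ = _
  rw [Λ.pi_mul]
  exact blockPerm_inv_apply _ _ _ _ _

theorem flat_quotQuot (p : Codiscrete (Λ.carrier n) × (∀ i, EPow Λ (k i) X)) :
    BorelCat.flat ((quotQuot Λ X k).obj p) = (quot Λ X (∑ i, k i)).obj ((concat Λ X k).obj p) := by
  refine BorelCat.obj_ext (sum_pi_inv p.1.as) fun A => ?_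
  obtain ⟨⟨i, b⟩, rfl⟩ :=
    (finSigmaFinEquiv (n := fun i => k ((Λ.pi n p.1.as)⁻¹ i))).surjective A
  refine (BorelCat.flat_pt ((quotQuot Λ X k).obj p) i b).trans ?_
  exact (concat_obj_pt p _ _).symm.trans
    (congrArg ((concat Λ X k).obj p).2 (concat_index p i b).symm)

/-- Write `g, gᵢ` and `g', g'ᵢ` for the group coordinates of `p` and `q`, and `cᵢ = g'ᵢgᵢ⁻¹`. After
right multiplication by `μ(g; gᵢ)` the claim is that the product of `μ(g'g⁻¹; c_{π(g)⁻¹(i)})` with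
it is `μ(g'; g'ᵢ)`, an instance of the action operad axiom. -/
theorem quotQuot_elt {p q : Codiscrete (Λ.carrier n) × (∀ i, EPow Λ (k i) X)} (f : p ⟶ q) :
    castIdx (sum_pi_inv p.1.as) (BorelCat.Hom.elt (BorelCat.flatHom ((quotQuot Λ X k).map f))) =
      BorelCat.Hom.elt ((quot Λ X (∑ i, k i)).map ((concat Λ X k).map f)) := by
  let c : ∀ i, Λ.carrier (k i) := fun i => (q.2 i).1.as * (p.2 i).1.as⁻¹
  have hc : BorelCat.innerElt ((quotQuot Λ X k).map f) = fun i => c ((Λ.pi n p.1.as)⁻¹ i) := by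
    funext i
    exact BorelCat.elt_comp_eqToHom _ _
  change castIdx _ (Λ.mul (q.1.as * p.1.as⁻¹) _) =
    Λ.mul q.1.as (fun i => (q.2 i).1.as) * (Λ.mul p.1.as fun i => (p.2 i).1.as)⁻¹
  rw [hc, eq_mul_inv_iff_mul_eq]
  have hk : ∀ i, k ((Λ.pi n p.1.as)⁻¹ (Λ.pi n p.1.as i)) = k i := fun i => by simp
  refine (Λ.mul_mul (k := k) (k' := fun i => k ((Λ.pi n p.1.as)⁻¹ i)) (q.1.as * p.1.as⁻¹) p.1.as
    (fun i => c ((Λ.pi n p.1.as)⁻¹ i)) (fun i => (p.2 i).1.as) hk).trans ?_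
  congr 1
  · simp
  · funext i
    -- The axiom shifts the index by `π(g)`, cancelling `π(g)⁻¹` only propositionally; hence the
    -- generalisation over `j = i`.
    have key : ∀ (j : Fin n) (_ : j = i) (h : k j = k i),
        castIdx h (c j) * (p.2 i).1.as = (q.2 i).1.as := by
      rintro _ rfl h
      exact inv_mul_cancel_right _ _
    exact key _ (by simp) _

theorem quotQuot_map_map {p q : Codiscrete (Λ.carrier n) × (∀ i, EPow Λ (k i) X)} (f : p ⟶ q)
    (i j : Fin n) (a : Fin (k ((Λ.pi n p.1.as)⁻¹ i))) (b : Fin (k ((Λ.pi n q.1.as)⁻¹ j))) (h1) (h2) :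
    HEq (BorelCat.Hom.map (BorelCat.Hom.map ((quotQuot Λ X k).map f) i j h1) a b h2)
      ((f.2 ((Λ.pi n p.1.as)⁻¹ i)).2
        ((Λ.pi _ (p.2 ((Λ.pi n p.1.as)⁻¹ i)).1.as)⁻¹ a)) := by
  -- Since `j = π(g'g⁻¹)(i)`, the places `i` and `j` come from the same place before normalisation.
  have hj : (Λ.pi n p.1.as)⁻¹ i = (Λ.pi n q.1.as)⁻¹ j := by
    obtain rfl : j = Λ.pi n (q.1.as * p.1.as⁻¹) i := Fin.ext h1
    simp
  have hq : (quot Λ X _).obj (q.2 ((Λ.pi n p.1.as)⁻¹ i)) = ((quotQuot Λ X k).obj q).pt j :=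
    congrArg (fun x => (quot Λ X (k x)).obj (q.2 x)) hj
  have e := BorelCat.elt_comp_eqToHom ((quot Λ X _).map (f.2 ((Λ.pi n p.1.as)⁻¹ i))) hq
  change HEq (BorelCat.Hom.map ((quot Λ X _).map (f.2 ((Λ.pi n p.1.as)⁻¹ i)) ≫ eqToHom hq) a b h2) _
  refine (BorelCat.map_comp_eqToHom_heq _ hq a b (Fin.cast (congrArg k hj.symm) b) rfl h2 ?_).trans
    (quot_map_heq _ _ _ _ _ rfl)
  exact Eq.trans h2 (congrArg (fun g => (Λ.pi (k ((Λ.pi n p.1.as)⁻¹ i)) g a).val) e)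

-- With all positions written as pairs of a block and a place in it, both sides return the entry of
-- `f` at the same original position, by `concat_index`.
variable (Λ X) in
theorem quotQuot_comp_mult (k : Fin n → ℕ) :
    quotQuot Λ X k ⋙ BorelCat.multFunctor Λ X = concat Λ X k ⋙ quot Λ X (∑ i, k i) := by
  refine Functor.hext flat_quotQuot fun p q f =>
    BorelCat.hom_heq (flat_quotQuot p) (flat_quotQuot q) ⟨_, quotQuot_elt f⟩ ?_
  intro A B A' B' h1 h2 hA hB
  obtain ⟨⟨i, a⟩, rfl⟩ :=
    (finSigmaFinEquiv (n := fun i => k ((Λ.pi n p.1.as)⁻¹ i))).surjective A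
  obtain ⟨⟨j, b⟩, rfl⟩ :=
    (finSigmaFinEquiv (n := fun i => k ((Λ.pi n q.1.as)⁻¹ i))).surjective B
  obtain ⟨h3, h4⟩ := BorelCat.flat_index_elt ((quotQuot Λ X k).map f) i a j b h1
  obtain rfl : Fin.cast (sum_pi_inv p.1.as) _ = A' := Fin.ext hA
  refine (BorelCat.flatHom_map ((quotQuot Λ X k).map f) i a j b h1 h3 h4).trans ?_
  refine (quotQuot_map_map f i j a b h3 h4).trans ?_
  exact (concat_map_heq f _ _).symm.trans (quot_map_heq _ _ _ h2 _ (concat_index p i a)).symm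

end
end EPow

/-! ### Assembly of the theorem -/

theorem isBorelConstruction (Λ : ActionOperad.{w}) : IsBorelConstruction.{w, u} Λ where
  coequalize X _ h := EPow.rightAct_comp_quot Λ X h
  universal _ _ _ hF := ⟨EPow.descend hF, EPow.quot_comp_descend hF, fun _ h =>
    EPow.quot_jointly_epi fun n => (h n).trans (EPow.quot_comp_descend hF n).symm⟩
  map F n := EPow.prod_map_comp_quot F.toFunctor n
  unit X := EPow.unit_comp_quot Λ X
  mult X _ k := EPow.quotQuot_comp_mult Λ X k

theorem quot_comp_comparison (Λ : ActionOperad.{w}) (X : Cat.{max w u, max w u}) (n : ℕ) :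
    EPow.quot Λ X n ⋙ ((comparison.{w, u} Λ).app X).toFunctor =
      (Codiscrete.functorOfFun (Λ.pi n)).prod (𝟭 (Fin n → X)) ⋙ EPow.quot symmOperad X n :=
  Functor.hext (fun _ => rfl) fun _ q _ => heq_of_eq (BorelCat.Hom.ext'
    ((map_mul (Λ.pi n) _ _).trans (congrArg (Λ.pi n q.1.as * ·) (map_inv (Λ.pi n) _)))
    fun _ _ _ _ => rfl)

/-- The club `Bπ : BΛ ⟶ BΣ`. -/
noncomputable def borelClub (Λ : ActionOperad.{u}) : Club (bPi.{u, u} Λ).toCatHom :=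
  operadOfCartesian onePtTerminal.{u} BorelCat.comparison_equifibered (bIso.{u, u} Λ)
    -- The closing `rfl` is the compatibility of `BΛ ≅ EΛ(1)` and `BΣ ≅ EΣ(1)` with `Bπ` and `π̃` at
    -- `1`: both composites keep the length and apply `π` to group elements.
    (k := (bPi.{u, u} Λ).toCatHom ≫ (bIso.{0, u} symmOperad).hom) rfl
    BorelCat.comparison_unit BorelCat.comparison_mult

/-- The first three conjuncts certify the model: its universal property and its compatibility with
the operad structure identify the monads as Borel constructions, and `π̃` is characterised on
classes. The remaining conjuncts are the three assertions of the theorem. -/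
theorem mainTheorem3 (Λ : ActionOperad.{u}) :
    IsBorelConstruction.{u, u} Λ ∧
    IsBorelConstruction.{0, u} symmOperad ∧
    (∀ (X : Cat.{u, u}) (n : ℕ),
      EPow.quot Λ X n ⋙ ((comparison.{u, u} Λ).app X).toFunctor =
        (Codiscrete.functorOfFun (Λ.pi n)).prod (𝟭 (Fin n → X)) ⋙ EPow.quot symmOperad X n) ∧
    IsCartesianMonad (borelMonad.{u, u} Λ) ∧
    IsCartesianMonad symmMonad.{u} ∧
    (comparison.{u, u} Λ).Equifibered ∧
    (∀ X : Cat.{u, u}, (borelMonad.{u, u} Λ).η.app X ≫ (comparison.{u, u} Λ).app X =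
      symmMonad.{u}.η.app X) ∧
    (∀ X : Cat.{u, u}, (borelMonad.{u, u} Λ).μ.app X ≫ (comparison.{u, u} Λ).app X =
      (borelMonad.{u, u} Λ).map ((comparison.{u, u} Λ).app X) ≫
        (comparison.{u, u} Λ).app (symmMonad.{u}.obj X) ≫ symmMonad.{u}.μ.app X) ∧
    ∃ (S : Club (bPi.{u, u} Λ).toCatHom) (e : S.inducedMonad ≅ borelMonad.{u, u} Λ),
      (∀ X : Cat.{u, u}, e.hom.app X ≫ (comparison.{u, u} Λ).app X = S.proj.app X) ∧
      ∀ X : Cat.{u, u}, e.hom.app X ≫ (borelMonad.{u, u} Λ).map (onePtTerminal.{u}.from X) =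
        collFst symmMonad.{u} onePtTerminal.{u}
          ((bPi.{u, u} Λ).toCatHom ≫ (bIso.{0, u} symmOperad).hom) X ≫ (bIso.{u, u} Λ).hom := by
  refine ⟨isBorelConstruction Λ, isBorelConstruction symmOperad, quot_comp_comparison Λ,
    BorelCat.isCartesianMonad Λ, BorelCat.isCartesianMonad symmOperad,
    BorelCat.comparison_equifibered, BorelCat.comparison_unit, BorelCat.comparison_mult,
    borelClub Λ, inducedIso _ _ _ _ _ _, fun X => ?_, fun X => ?_⟩
  · exact collIso_app onePtTerminal.{u} BorelCat.comparison_equifibered (bIso.{u, u} Λ) rfl X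
  · exact collIso_map onePtTerminal.{u} BorelCat.comparison_equifibered (bIso.{u, u} Λ) rfl X
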